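/- Let $d\ge 1$, let $\mathbb S^d=\{x\in\mathbb R^{d+1}:\|x\|=1\}$ with surface area measure $\sigma_d$ and total area $\|\sigma_d\|$, and let $\theta(x,y)=\arccos\langle x,y\rangle$. For $j\ge 0$ let $\mathcal H_j^d$ be the space of restrictions to $\mathbb S^d$ of the real homogeneous harmonic polynomials of degree $j$ on $\mathbb R^{d+1}$, and let $\mathcal Y_{j,m,d}$, $1\le m\le\dim\mathcal H_j^d$, be elements of $\mathcal H_j^d$ with $\int_{\mathbb S^d}\mathcal Y_{j,m,d}\,\mathcal Y_{j,m',d}\,d\sigma_d=\delta_{mm'}\|\sigma_d\|$. With $C_j^{r}$ the Gegenbauer polynomials, put $$c_j(d,u)=\frac{C_j^{(d-1)/2}(u)}{C_j^{(d-1)/2}(1)},\qquad c_{j,d}=\Big(\frac{d-1}{(2j+d-1)\,C_j^{(d-1)/2}(1)}\Big)^{1/2}\qquad(d\ge 2);$$ for $d=1$ these are read as their limits as the order $r=(d-1)/2$ tends to $0$: $c_j(1,\cdot)$ is the Chebyshev polynomial $T_j$, $c_{0,1}=1$, and $c_{j,1}=2^{-1/2}$ for $j\ge1$. Let $(\varphi_{j,d})_{j\ge0}$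 be continuous positive definite functions $\mathbb R\to\mathbb R$ and $\psi:[-1,1]\times\mathbb R\to\mathbb R$ a kernel such that $$\psi(u,t)=\sum_{j=0}^\infty\varphi_{j,d}(t)\,c_j(d,u),$$ the series converging uniformly on $[-1,1]\times\mathbb R$. On a probability space, let $X_{j,m,d}=\{X_{j,m,d}(t):t\in\mathbb R\}$ ($j\ge0$, $1\le m\le\dim\mathcal H_j^d$) be independent zero-mean Gaussian processes with $\operatorname{cov}(X_{j,m,d}(t),X_{j',m',d}(s))=\varphi_{j,d}(t-s)\,\delta_{jj'}\delta_{mm'}$ (so each of them is stationary). Consider the series $$\sum_{j=0}^\infty c_{j,d}\sum_{m=1}^{\dim\mathcal H_j^d}X_{j,m,d}(t)\,\mathcal Y_{j,m,d}(x),\qquad (x,t)\in\mathbb S^d\times\mathbb R .\qquad(*)$$ Then: 1. For every $(x,t)$ the series $(*)$ converges almost surely. If all the processes $X_{j,m,d}$ are jointly measurable in $(\omega,t)$, there is a random field on $\mathbb S^d\times\mathbb R$, that is, a real function $Z$ jointly measurable in $(\omega,x,t)$, such that for every $(x,t)$ the series $(*)$ converges to $Z(x,t)$ in probability. 2. Let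 $Z$ be any random field on $\mathbb S^d\times\mathbb R$ such that for every $(x,t)$ the series $(*)$ converges to $Z(x,t)$ in probability. Then for every $(x,t)$ the convergence to $Z(x,t)$ also holds almost surely and in $L^2$, and $Z$ is a zero-mean Gaussian random field which is isotropic stationary (it is square integrable, its mean is constant, and its covariance is a function of $\cos\theta(x,y)$ and $t-s$ only), with covariance function $$\operatorname{cov}\big(Z(x,t),Z(y,s)\big)=\psi\big(\cos\theta(x,y),\,t-s\big)=\sum_{j=0}^\infty\varphi_{j,d}(t-s)\,c_j\big(d,\cos\theta(x,y)\big)$$ for all $x,y\in\mathbb S^d$ and $t,s\in\mathbb R$. -/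

import Mathlib

open MeasureTheory ProbabilityTheory Filter Topology

noncomputable section

namespace SphereTime

/-- The unit sphere of `ℝ^(d+1)` with its Euclidean norm. -/
abbrev Sph (d : ℕ) : Type := Metric.sphere (0 : EuclideanSpace ℝ (Fin (d + 1))) 1

/-- The surface area measure of the sphere; its total mass is the surface area. -/
def surfaceMeasure (d : ℕ) : Measure (Sph d) :=
  (volume : Measure (EuclideanSpace ℝ (Fin (d + 1)))).toSphere

/-- Great circle distance. -/
def geodesicDist {d : ℕ} (x y : Sph d) : ℝ :=
  Real.arccos (inner ℝ (x : EuclideanSpace ℝ (Fin (d + 1))) y)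

/-! ### Spherical harmonics -/

/-- The Laplacian on real polynomials in `d + 1` variables. -/
def polyLaplacian (d : ℕ) :
    MvPolynomial (Fin (d + 1)) ℝ →ₗ[ℝ] MvPolynomial (Fin (d + 1)) ℝ :=
  ∑ i : Fin (d + 1),
    (MvPolynomial.pderiv (R := ℝ) i).toLinearMap ∘ₗ (MvPolynomial.pderiv (R := ℝ) i).toLinearMap

/-- Homogeneous harmonic polynomials of degree `j` in `d + 1` variables. -/
def harmonicPolynomials (d j : ℕ) : Submodule ℝ (MvPolynomial (Fin (d + 1)) ℝ) :=
  MvPolynomial.homogeneousSubmodule (Fin (d + 1)) ℝ j ⊓ LinearMap.ker (polyLaplacian d)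

/-- Restriction of a polynomial function to the sphere. -/
def restrictToSphere (d : ℕ) : MvPolynomial (Fin (d + 1)) ℝ →ₗ[ℝ] (Sph d → ℝ) where
  toFun p := fun x => MvPolynomial.eval (fun i => (x : EuclideanSpace ℝ (Fin (d + 1))) i) p
  map_add' p q := by ext x; simp
  map_smul' a p := by ext x; simp [MvPolynomial.smul_eval]

/-- The space of spherical harmonics of degree `j` on the `d`-dimensional sphere. -/
def sphericalHarmonics (d j : ℕ) : Submodule ℝ (Sph d → ℝ) :=
  (harmonicPolynomials d j).map (restrictToSphere d)

/-- The dimension of the space of spherical harmonics of degree `j`. -/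
def dimH (d j : ℕ) : ℕ := Module.finrank ℝ (sphericalHarmonics d j)

/-- The pairs `(j, m)` with `m` running over `dim H_j` values. -/
abbrev HarmIndex (d : ℕ) : Type := Σ j : ℕ, Fin (dimH d j)

/-- For every degree `j`, the `dim H_j` functions `Y (j, m)` are spherical harmonics of degree `j`,
pairwise orthogonal in `L²` of the surface measure, and with squared norm the surface area. -/
structure IsNormalizedHarmonicSystem (d : ℕ) (Y : HarmIndex d → Sph d → ℝ) : Prop where
  mem : ∀ (j : ℕ) (m : Fin (dimH d j)), Y ⟨j, m⟩ ∈ sphericalHarmonics d j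
  orthogonal : ∀ (j : ℕ) (m m' : Fin (dimH d j)),
    ∫ x, Y ⟨j, m⟩ x * Y ⟨j, m'⟩ x ∂(surfaceMeasure d) =
      if m = m' then (surfaceMeasure d).real Set.univ else 0

/-! ### Gegenbauer polynomials -/

/-- The Gegenbauer polynomial `C_n^r`,
`C_n^r(x) = ∑_{k ≤ n/2} (-1)^k (r)_{n-k} / (k! (n-2k)!) (2x)^{n-2k}`. -/
def gegenbauer (r : ℝ) (n : ℕ) (x : ℝ) : ℝ :=
  ∑ k ∈ Finset.range (n / 2 + 1),
    (-1) ^ k * (ascPochhammer ℝ (n - k)).eval r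
      / ((k.factorial : ℝ) * ((n - 2 * k).factorial : ℝ)) * (2 * x) ^ (n - 2 * k)

/-- The standardized Gegenbauer polynomial `c_j(d, x) = C_j^r(x) / C_j^r(1)`, `r = (d-1)/2`.
On the circle (`d = 1`, where the quotient reads `0 / 0` for `j ≥ 1`) it is its limit as `r → 0`,
the Chebyshev polynomial `T_j`. -/
def stdGegenbauer (d j : ℕ) (x : ℝ) : ℝ :=
  if d = 1 then (Polynomial.Chebyshev.T ℝ (j : ℤ)).eval x
  else gegenbauer (((d : ℝ) - 1) / 2) j x / gegenbauer (((d : ℝ) - 1) / 2) j 1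

/-- The coefficient `c_{j,d} = ((d-1) / ((2j+d-1) C_j^r(1)))^{1/2}`, `r = (d-1)/2`.
On the circle (`d = 1`, where the quotient reads `0 / 0`) it is its limit as `r → 0`,
which is `1` for `j = 0` and `(1/2)^{1/2}` for `j ≥ 1`. -/
def fieldCoeff (d j : ℕ) : ℝ :=
  if d = 1 then (if j = 0 then 1 else √(1 / 2))
  else √(((d : ℝ) - 1) / ((2 * (j : ℝ) + (d : ℝ) - 1) * gegenbauer (((d : ℝ) - 1) / 2) j 1))

/-! ### Kernels and Schoenberg functions -/

/-- Positive definite real-valued functions on `ℝ`. -/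
def IsPosDefFun (φ : ℝ → ℝ) : Prop :=
  ∀ (n : ℕ) (t : Fin n → ℝ), (Matrix.of fun i k : Fin n => φ (t i - t k)).PosSemidef

/-- `φ` is the sequence of Schoenberg functions of the kernel `ψ : [-1, 1] × ℝ → ℝ`: the `φ j` are
continuous and positive definite, and `ψ (u, t) = ∑_j φ_j(t) c_j(d, u)` uniformly on
`[-1, 1] × ℝ`. Values of `ψ` outside `[-1, 1] × ℝ` play no role. -/
structure IsSchoenbergExpansion (d : ℕ) (ψ : ℝ → ℝ → ℝ) (φ : ℕ → ℝ → ℝ) : Prop where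
  continuous : ∀ j, Continuous (φ j)
  posDef : ∀ j, IsPosDefFun (φ j)
  uniform : TendstoUniformlyOn
    (fun (n : ℕ) (q : ℝ × ℝ) => ∑ j ∈ Finset.range n, φ j q.2 * stdGegenbauer d j q.1)
    (fun q => ψ q.1 q.2) atTop (Set.Icc (-1) 1 ×ˢ Set.univ)

/-! ### Random fields on the sphere cross time -/

variable {Ω : Type*} [MeasurableSpace Ω]

/-- A real-valued random field on the sphere cross time is a jointly measurable mapping. -/
def IsRandomField {d : ℕ} (Z : Sph d × ℝ → Ω → ℝ) : Prop :=
  Measurable fun p : Ω × (Sph d × ℝ) => Z p.2 p.1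

/-- Square integrable, with constant mean, and with a covariance function that is spatially
isotropic and temporally stationary. -/
structure IsIsotropicStationary {d : ℕ} (P : Measure Ω) (Z : Sph d × ℝ → Ω → ℝ) : Prop where
  memLp : ∀ p, MemLp (Z p) 2 P
  mean : ∃ c : ℝ, ∀ p, ∫ ω, Z p ω ∂P = c
  cov : ∃ k : ℝ → ℝ → ℝ, ∀ (x y : Sph d) (t s : ℝ),
    cov[Z (x, t), Z (y, s); P] = k (Real.cos (geodesicDist x y)) (t - s)

/-- The processes `X (j, m)` are independent zero-mean Gaussian processes on `ℝ`, with
`cov (X_{j,m}(t), X_{j',m'}(s)) = φ_j(t - s) δ_{jj'} δ_{mm'}` (so each of them is stationary). -/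
structure IsSpectralFamily (d : ℕ) (P : Measure Ω) (φ : ℕ → ℝ → ℝ)
    (X : HarmIndex d → ℝ → Ω → ℝ) : Prop where
  gaussian : ∀ p, IsGaussianProcess (X p) P
  mean : ∀ p t, ∫ ω, X p t ω ∂P = 0
  cov : ∀ p q t s, cov[X p t, X q s; P] = if p = q then φ p.1 (t - s) else 0
  indep : iIndepFun (fun p ω t => X p t ω) P

/-- The partial sums
`∑_{j < n} c_{j,d} ∑_{m = 1}^{dim H_j} X_{j,m}(t) Y_{j,m}(x)` at the point `(x, t)`. -/
def partialField (d : ℕ) (Y : HarmIndex d → Sph d → ℝ) (X : HarmIndex d → ℝ → Ω → ℝ)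
    (n : ℕ) (p : Sph d × ℝ) (ω : Ω) : ℝ :=
  ∑ j ∈ Finset.range n, fieldCoeff d j *
    ∑ m : Fin (dimH d j), X ⟨j, m⟩ p.2 ω * Y ⟨j, m⟩ p.1

/-- `Z` is a random field which at every point is the sum of the series, in probability. -/
structure IsSeriesField (d : ℕ) (P : Measure Ω) (Y : HarmIndex d → Sph d → ℝ)
    (X : HarmIndex d → ℝ → Ω → ℝ) (Z : Sph d × ℝ → Ω → ℝ) : Prop where
  field : IsRandomField Z
  sum : ∀ p, TendstoInMeasure P (fun n => partialField d Y X n p) atTop (Z p)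

end SphereTime

end

/-! Let `V_j(x,t)` be the term of degree `j` of the series. These terms are centred and jointly
Gaussian over all degrees and points, with `cov(V_j(x,t), V_k(y,s)) = δ_jk φ_j(t-s) c_j(d,⟨x,y⟩)`
(`covariance_fieldTerm`). The covariance comes from the addition theorem `∑_m Y_m(x) Y_m(y) = dim
H_j · c_j(d,⟨x,y⟩)` together with `c_{j,d}² dim H_j = 1`.

At a fixed point the terms are therefore independent, and their variances sum to the diagonal value
of `ψ` at time lag `0`. Kolmogorov's one-series theorem gives almost sure convergence, Fatou's lemma
gives convergence in `L²`, and Gaussianity, mean and covariance pass to the limit. A limit in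
probability coincides almost surely with the almost sure limit.

For the addition theorem, a rotation acts on the `Y_m` by an orthogonal matrix, so the kernel is
rotation invariant. With one argument at the pole it is a zonal harmonic, and zonal harmonic
polynomials of degree `j` form a line, spanned by an explicit polynomial built from the Gegenbauer
recurrence. Integrating the diagonal gives the constant. The dimension of `H_j` follows from the
surjectivity of the Laplacian between spaces of forms. -/

noncomputable section

namespace SphereTime

/-! ### The three-term recurrence of the Gegenbauer polynomials -/

/-- The `k`-th term of the Gegenbauer polynomial, extended by zero. -/
def gegenbauerTerm (r : ℝ) (n : ℕ) (x : ℝ) (k : ℕ) : ℝ :=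
  if 2 * k ≤ n then (-1) ^ k * (ascPochhammer ℝ (n - k)).eval r
      / ((k.factorial : ℝ) * ((n - 2 * k).factorial : ℝ)) * (2 * x) ^ (n - 2 * k) else 0

theorem gegenbauer_eq_sum (r : ℝ) (n : ℕ) (x : ℝ) {N : ℕ} (hN : n / 2 + 1 ≤ N) :
    gegenbauer r n x = ∑ k ∈ Finset.range N, gegenbauerTerm r n x k := by
  rw [gegenbauer, ← Finset.sum_subset (Finset.range_subset_range.2 hN)]
  · refine Finset.sum_congr rfl fun k hk => ?_
    rw [gegenbauerTerm, if_pos (by have := Finset.mem_range.1 hk; omega)]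
  · intro k _ hk
    rw [gegenbauerTerm, if_neg (by have := mt Finset.mem_range.2 hk; omega)]

theorem gegenbauer_zero (r x : ℝ) : gegenbauer r 0 x = 1 := by
  simp [gegenbauer]

theorem gegenbauer_one (r x : ℝ) : gegenbauer r 1 x = 2 * r * x := by
  simp [gegenbauer]; ring

theorem gegenbauerTerm_zero_recurrence (r x : ℝ) (n : ℕ) :
    ((n : ℝ) + 2) * gegenbauerTerm r (n + 2) x 0 =
      2 * x * (n + 1 + r) * gegenbauerTerm r (n + 1) x 0 := by
  simp only [gegenbauerTerm, mul_zero, zero_le, if_true, pow_zero, Nat.sub_zero,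
    Nat.factorial_zero, Nat.factorial_succ, ascPochhammer_succ_eval, Nat.cast_mul]
  push_cast
  have := Nat.factorial_pos n
  field_simp
  ring

/-- The recurrence holds term by term: with these index shifts all three terms carry the same power
of `x`. -/
theorem gegenbauerTerm_succ_recurrence (r x : ℝ) (n k : ℕ) :
    ((n : ℝ) + 2) * gegenbauerTerm r (n + 2) x (k + 1) =
      2 * x * (n + 1 + r) * gegenbauerTerm r (n + 1) x (k + 1)
        - (n + 2 * r) * gegenbauerTerm r n x k := by
  by_cases h : 2 * k ≤ n
  · obtain ⟨l, rfl⟩ := Nat.exists_eq_add_of_le h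
    have e1 : 2 * k + l + 2 - (k + 1) = k + l + 1 := by omega
    have e2 : 2 * k + l + 2 - 2 * (k + 1) = l := by omega
    have e3 : 2 * k + l - k = k + l := by omega
    have e4 : 2 * k + l - 2 * k = l := by omega
    have hk := Nat.factorial_pos k
    -- For `n = 2k` the middle term is zero because `2(k+1) > n+1`, so this boundary case is
    -- separate.
    rcases l with _ | l
    · rw [gegenbauerTerm, gegenbauerTerm, gegenbauerTerm, if_pos (by omega), if_neg (by omega),
        if_pos (by omega), e1, e2, e3, e4]
      simp only [Nat.factorial_succ, ascPochhammer_succ_eval, Nat.cast_mul, pow_succ,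
        Nat.factorial_zero, add_zero]
      push_cast
      field_simp
      ring
    · have e5 : 2 * k + (l + 1) + 1 - (k + 1) = k + (l + 1) := by omega
      have e6 : 2 * k + (l + 1) + 1 - 2 * (k + 1) = l := by omega
      rw [gegenbauerTerm, gegenbauerTerm, gegenbauerTerm, if_pos (by omega), if_pos (by omega),
        if_pos (by omega), e1, e2, e3, e4, e5, e6]
      have hl := Nat.factorial_pos l
      rw [ascPochhammer_succ_eval]
      generalize (ascPochhammer ℝ (k + (l + 1))).eval r = a
      simp only [Nat.factorial_succ, Nat.cast_mul, pow_succ]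
      push_cast
      field_simp
      ring
  · rw [gegenbauerTerm, gegenbauerTerm, gegenbauerTerm, if_neg (by omega), if_neg (by omega),
      if_neg (by omega)]
    simp

theorem gegenbauer_recurrence (r x : ℝ) (n : ℕ) :
    ((n : ℝ) + 2) * gegenbauer r (n + 2) x =
      2 * x * (n + 1 + r) * gegenbauer r (n + 1) x - (n + 2 * r) * gegenbauer r n x := by
  rw [gegenbauer_eq_sum r (n + 2) x (N := n / 2 + 2) (by omega),
    gegenbauer_eq_sum r (n + 1) x (N := n / 2 + 2) (by omega),
    gegenbauer_eq_sum r n x (N := n / 2 + 1) (by omega),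
    Finset.sum_range_succ' _ (n / 2 + 1), Finset.sum_range_succ' _ (n / 2 + 1), mul_add, mul_add,
    gegenbauerTerm_zero_recurrence, Finset.mul_sum, Finset.mul_sum, Finset.mul_sum,
    Finset.sum_congr rfl fun k _ => gegenbauerTerm_succ_recurrence r x n k,
    Finset.sum_sub_distrib]
  ring

/-- The closed form satisfies the recurrence at `x = 1`. It serves for positivity, for normalizing
the recurrence, and for the dimension formula. -/
theorem gegenbauer_at_one (r : ℝ) (n : ℕ) :
    gegenbauer r n 1 = (ascPochhammer ℝ n).eval (2 * r) / n.factorial := by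
  induction n using Nat.twoStepInduction with
  | zero => simp [gegenbauer_zero]
  | one => simp [gegenbauer_one]
  | more n h0 h1 =>
    have h := gegenbauer_recurrence r 1 n
    rw [h0, h1] at h
    have hn := Nat.factorial_pos n
    have h2 : (n : ℝ) + 2 ≠ 0 := by positivity
    rw [← mul_right_inj' h2, h]
    simp only [ascPochhammer_succ_eval, Nat.factorial_succ, Nat.cast_mul]
    push_cast
    field_simp
    ring

theorem gegenbauer_at_one_pos {d : ℕ} (hd : 2 ≤ d) (n : ℕ) :
    0 < gegenbauer (((d : ℝ) - 1) / 2) n 1 := by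
  rw [gegenbauer_at_one]
  have : (2 : ℝ) ≤ d := by exact_mod_cast hd
  have := ascPochhammer_pos n (2 * (((d : ℝ) - 1) / 2)) (by linarith)
  positivity

/-! ### The standardized Gegenbauer polynomials -/

theorem stdGegenbauer_zero (d : ℕ) (x : ℝ) : stdGegenbauer d 0 x = 1 := by
  by_cases h : d = 1 <;> simp [stdGegenbauer, h, gegenbauer_zero]

theorem stdGegenbauer_one {d : ℕ} (hd : 1 ≤ d) (x : ℝ) : stdGegenbauer d 1 x = x := by
  by_cases h : d = 1
  · simp [stdGegenbauer, h]
  · have : (2 : ℝ) ≤ d := by exact_mod_cast (by omega : 2 ≤ d)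
    have h0 : (d : ℝ) - 1 ≠ 0 := by linarith
    simp only [stdGegenbauer, h, if_false, gegenbauer_one]
    field_simp

/-- After normalization the circle is no longer exceptional: at `d = 1` this is `n + 1` times the
Chebyshev recurrence. It allows the zonal harmonics to be built uniformly in `d`. -/
theorem stdGegenbauer_recurrence {d : ℕ} (hd : 1 ≤ d) (n : ℕ) (x : ℝ) :
    ((n : ℝ) + d) * stdGegenbauer d (n + 2) x =
      (2 * n + d + 1) * (x * stdGegenbauer d (n + 1) x) - (n + 1) * stdGegenbauer d n x := by
  by_cases h : d = 1
  · subst h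
    simp only [stdGegenbauer, if_true]
    push_cast
    rw [Polynomial.Chebyshev.T_add_two]
    simp only [Polynomial.eval_sub, Polynomial.eval_mul, Polynomial.eval_X, Polynomial.eval_ofNat]
    ring
  · have hd2 : 2 ≤ d := by omega
    have hdr : (2 : ℝ) ≤ d := by exact_mod_cast hd2
    have hr := gegenbauer_recurrence (((d : ℝ) - 1) / 2) x n
    have hp0 := ascPochhammer_pos n (2 * (((d : ℝ) - 1) / 2)) (by linarith)
    have e0 := gegenbauer_at_one (((d : ℝ) - 1) / 2) n
    have e1 := gegenbauer_at_one (((d : ℝ) - 1) / 2) (n + 1)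
    have e2 := gegenbauer_at_one (((d : ℝ) - 1) / 2) (n + 2)
    simp only [stdGegenbauer, h, if_false, e0, e1, e2]
    generalize gegenbauer (((d : ℝ) - 1) / 2) (n + 2) x = c2 at *
    generalize gegenbauer (((d : ℝ) - 1) / 2) (n + 1) x = c1 at *
    generalize gegenbauer (((d : ℝ) - 1) / 2) n x = c0 at *
    have hn := Nat.factorial_pos n
    have hc2 : c2 = (2 * x * (n + 1 + ((d : ℝ) - 1) / 2) * c1 -
        (n + 2 * (((d : ℝ) - 1) / 2)) * c0) / (n + 2) := by
      field_simp; linarith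
    have hn0 : (0 : ℝ) ≤ n := n.cast_nonneg
    have g1 : 2 * (((d : ℝ) - 1) / 2) + n ≠ 0 := by linarith
    have g2 : 2 * (((d : ℝ) - 1) / 2) + (n + 1) ≠ 0 := by linarith
    rw [ascPochhammer_succ_eval, ascPochhammer_succ_eval, hc2]
    simp only [Nat.factorial_succ]
    push_cast
    have e3 : 2 * (((d : ℝ) - 1) / 2) = d - 1 := by ring
    rw [e3] at hp0 g1 g2 ⊢
    generalize Polynomial.eval ((d : ℝ) - 1) (ascPochhammer ℝ n) = a at *
    have ha : a ≠ 0 := hp0.ne'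
    have g3 : (n : ℝ) + d ≠ 0 := by linarith
    have g4 : (d : ℝ) - 1 + (n + 1) = n + d := by ring
    rw [g4]
    field_simp
    ring

theorem stdGegenbauer_at_one {d : ℕ} (hd : 1 ≤ d) (n : ℕ) : stdGegenbauer d n 1 = 1 := by
  by_cases h : d = 1
  · simp [stdGegenbauer, h]
  · simp only [stdGegenbauer, h, if_false]
    exact div_self (gegenbauer_at_one_pos (by omega) n).ne'

/-! ### Harmonic polynomials -/

theorem polyLaplacian_apply (d : ℕ) (p : MvPolynomial (Fin (d + 1)) ℝ) :
    polyLaplacian d p = ∑ i, MvPolynomial.pderiv i (MvPolynomial.pderiv i p) := by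
  simp [polyLaplacian]

theorem mem_harmonicPolynomials {d j : ℕ} {p : MvPolynomial (Fin (d + 1)) ℝ} :
    p ∈ harmonicPolynomials d j ↔ p.IsHomogeneous j ∧ polyLaplacian d p = 0 := by
  simp [harmonicPolynomials]

theorem coeff_polyLaplacian (d : ℕ) (p : MvPolynomial (Fin (d + 1)) ℝ) (m : Fin (d + 1) →₀ ℕ) :
    (polyLaplacian d p).coeff m =
      ∑ i, p.coeff (m + Finsupp.single i 2) * (m i + 2) * (m i + 1) := by
  rw [polyLaplacian_apply, MvPolynomial.coeff_sum]
  refine Finset.sum_congr rfl fun i _ => ?_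
  rw [MvPolynomial.coeff_pderiv, MvPolynomial.coeff_pderiv, add_assoc, ← Finsupp.single_add]
  simp only [Finsupp.add_apply, Finsupp.single_eq_same]
  push_cast
  ring

/-- A harmonic polynomial is determined by its Cauchy data on the hyperplane `x₀ = 0`. -/
theorem eq_zero_of_polyLaplacian_eq_zero {d : ℕ} {p : MvPolynomial (Fin (d + 1)) ℝ}
    (hp : polyLaplacian d p = 0) (h : ∀ m, m 0 ≤ 1 → p.coeff m = 0) : p = 0 := by
  suffices H : ∀ k m, m 0 = k → p.coeff m = 0 by
    ext m; simpa using H _ m rfl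
  intro k
  induction k using Nat.strong_induction_on with
  | _ k ih =>
    intro m hm
    by_cases hk : k ≤ 1
    · exact h m (hm ▸ hk)
    · obtain ⟨m', rfl⟩ : ∃ m', m = m' + Finsupp.single 0 2 :=
        ⟨m - Finsupp.single 0 2, (tsub_add_cancel_of_le
          (Finsupp.single_le_iff.2 (by omega))).symm⟩
      -- In this coefficient of the Laplacian, `m' + 2e₀` enters with a nonzero factor, and every
      -- other monomial has `x₀`-exponent `k - 2`, where the induction hypothesis applies.
      have e := coeff_polyLaplacian d p m'
      rw [hp, MvPolynomial.coeff_zero, Finset.sum_eq_single 0] at e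
      · have h1 : ((m' 0 : ℝ) + 2) ≠ 0 := by positivity
        have h2 : ((m' 0 : ℝ) + 1) ≠ 0 := by positivity
        simpa [h1, h2] using e.symm
      · intro i _ hi
        rw [ih (m' 0) (by simp at hm; omega) _ (by simp [hi])]
        simp
      · simp

theorem isHomogeneous_polyLaplacian {d j : ℕ} {p : MvPolynomial (Fin (d + 1)) ℝ}
    (hp : p.IsHomogeneous j) : (polyLaplacian d p).IsHomogeneous (j - 2) := by
  rw [polyLaplacian_apply]
  exact MvPolynomial.IsHomogeneous.sum _ _ _ fun i _ => hp.pderiv.pderiv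

instance (n j : ℕ) : FiniteDimensional ℝ (MvPolynomial.homogeneousSubmodule (Fin n) ℝ j) :=
  Module.Finite.iff_fg.2 (MvPolynomial.homogeneousSubmodule_fg _ _ j)

theorem finrank_homogeneousSubmodule (n j : ℕ) :
    Module.finrank ℝ (MvPolynomial.homogeneousSubmodule (Fin n) ℝ j) = n.multichoose j := by
  have hb := (MvPolynomial.basisMonomials (Fin n) ℝ).linearIndependent.comp
    (fun m : (Finset.univ.finsuppAntidiag j : Finset (Fin n →₀ ℕ)) => (m : Fin n →₀ ℕ))
    Subtype.val_injective
  have hc := finrank_span_eq_card hb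
  rw [Fintype.card_coe, Finset.card_finsuppAntidiag_nat_eq_multichoose, Finset.card_univ,
    Fintype.card_fin] at hc
  have hs : MvPolynomial.homogeneousSubmodule (Fin n) ℝ j = Submodule.span ℝ (Set.range
      (MvPolynomial.basisMonomials (Fin n) ℝ ∘
        fun m : (Finset.univ.finsuppAntidiag j : Finset (Fin n →₀ ℕ)) => (m : Fin n →₀ ℕ))) := by
    rw [MvPolynomial.homogeneousSubmodule_eq_finsupp_supported,
      AddMonoidAlgebra.supported_eq_span_single, Set.range_comp]
    erw [Subtype.range_coe]
    congr 1
    ext p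
    simp [Finset.mem_finsuppAntidiag, Finsupp.degree_eq_sum, MvPolynomial.single_eq_monomial]
  rw [hs, hc]

/-- The map `q ↦ Δ(x₀² q)` is an endomorphism of the finite-dimensional space of forms of degree
`j`. It is injective because a harmonic multiple of `x₀²` has zero Cauchy data, hence it is
surjective. -/
theorem surjOn_polyLaplacian (d j : ℕ) :
    (MvPolynomial.homogeneousSubmodule (Fin (d + 1)) ℝ (j + 2)).map (polyLaplacian d) =
      MvPolynomial.homogeneousSubmodule (Fin (d + 1)) ℝ j := by
  have hm : ∀ q ∈ MvPolynomial.homogeneousSubmodule (Fin (d + 1)) ℝ j,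
      q * MvPolynomial.X 0 ^ 2 ∈ MvPolynomial.homogeneousSubmodule (Fin (d + 1)) ℝ (j + 2) :=
    fun q hq => MvPolynomial.IsHomogeneous.mul hq (MvPolynomial.isHomogeneous_X_pow _ _)
  let T : MvPolynomial (Fin (d + 1)) ℝ →ₗ[ℝ] MvPolynomial (Fin (d + 1)) ℝ :=
    polyLaplacian d ∘ₗ LinearMap.mulRight ℝ (MvPolynomial.X 0 ^ 2)
  have hT : ∀ q ∈ MvPolynomial.homogeneousSubmodule (Fin (d + 1)) ℝ j,
      T q ∈ MvPolynomial.homogeneousSubmodule (Fin (d + 1)) ℝ j :=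
    fun q hq => isHomogeneous_polyLaplacian (hm q hq)
  have hinj : Function.Injective (T.restrict hT) := by
    rw [← LinearMap.ker_eq_bot, LinearMap.ker_eq_bot']
    rintro ⟨q, hq⟩ h0
    have h1 : polyLaplacian d (q * MvPolynomial.X 0 ^ 2) = 0 := congrArg Subtype.val h0
    have h2 := eq_zero_of_polyLaplacian_eq_zero h1 (fun m hm => by
      rw [MvPolynomial.X_pow_eq_monomial, MvPolynomial.coeff_mul_monomial', if_neg]
      rw [Finsupp.single_le_iff]; omega)
    ext1
    simpa using h2
  have hsurj := LinearMap.injective_iff_surjective.1 hinj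
  apply le_antisymm
  · rintro _ ⟨p, hp, rfl⟩
    exact isHomogeneous_polyLaplacian hp
  · intro q hq
    obtain ⟨⟨p, hp⟩, hpq⟩ := hsurj ⟨q, hq⟩
    exact ⟨_, hm p hp, congrArg Subtype.val hpq⟩

theorem finrank_harmonicPolynomials_add_two (d j : ℕ) :
    Module.finrank ℝ (harmonicPolynomials d (j + 2)) + (d + 1).multichoose j =
      (d + 1).multichoose (j + 2) := by
  rw [← finrank_homogeneousSubmodule, ← finrank_homogeneousSubmodule]
  have h := LinearMap.finrank_range_add_finrank_ker
    ((polyLaplacian d).domRestrict (MvPolynomial.homogeneousSubmodule (Fin (d + 1)) ℝ (j + 2)))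
  rw [← h, LinearMap.range_domRestrict, surjOn_polyLaplacian, LinearMap.ker_domRestrict,
    ← Submodule.finrank_map_subtype_eq, Submodule.map_comap_subtype, add_comm]
  rfl

theorem finrank_harmonicPolynomials_of_lt_two {d j : ℕ} (hj : j < 2) :
    Module.finrank ℝ (harmonicPolynomials d j) = (d + 1).multichoose j := by
  rw [← finrank_homogeneousSubmodule]
  suffices h : harmonicPolynomials d j = MvPolynomial.homogeneousSubmodule (Fin (d + 1)) ℝ j by
    rw [h]
  refine inf_eq_left.2 fun p hp => ?_
  change polyLaplacian d p = 0
  ext m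
  rw [coeff_polyLaplacian, MvPolynomial.coeff_zero]
  refine Finset.sum_eq_zero fun i _ => ?_
  rw [MvPolynomial.IsHomogeneous.coeff_eq_zero hp]
  · simp
  · simp; omega

theorem cast_multichoose (n j : ℕ) :
    (n.multichoose j : ℝ) = (ascPochhammer ℝ j).eval (n : ℝ) / j.factorial := by
  rw [Nat.multichoose_eq, ascPochhammer_nat_eq_natCast_ascFactorial,
    Nat.ascFactorial_eq_factorial_mul_choose']
  have := Nat.factorial_pos j
  push_cast
  field_simp

theorem ascPochhammer_eval_succ_left (n : ℕ) (x : ℝ) :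
    (ascPochhammer ℝ (n + 1)).eval x = x * (ascPochhammer ℝ n).eval (x + 1) := by
  simp [ascPochhammer_succ_left, Polynomial.eval_comp]

/-- The dimension of the space of harmonic homogeneous polynomials. -/
theorem finrank_harmonicPolynomials_mul (d j : ℕ) :
    (Module.finrank ℝ (harmonicPolynomials d j) : ℝ) * (d - 1) =
      (2 * j + d - 1) * gegenbauer (((d : ℝ) - 1) / 2) j 1 := by
  have e : 2 * (((d : ℝ) - 1) / 2) = d - 1 := by ring
  match j with
  | 0 => simp [finrank_harmonicPolynomials_of_lt_two, gegenbauer_zero]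
  | 1 =>
    simp [finrank_harmonicPolynomials_of_lt_two, gegenbauer_one]
    ring
  | j + 2 =>
    -- Both monomial counts and the value at `1` contain the common factor `(d+1)_j`; what remains
    -- is a polynomial identity in `j` and `d`.
    have h := finrank_harmonicPolynomials_add_two d j
    rw [← Nat.cast_inj (R := ℝ), Nat.cast_add, cast_multichoose, cast_multichoose,
      ← eq_sub_iff_add_eq] at h
    have e2 : (ascPochhammer ℝ (j + 2)).eval ((d : ℝ) - 1) =
        (d - 1) * (d * (ascPochhammer ℝ j).eval ((d : ℝ) + 1)) := by
      rw [ascPochhammer_eval_succ_left, sub_add_cancel, ascPochhammer_eval_succ_left]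
    rw [h, gegenbauer_at_one, e, e2, ascPochhammer_succ_eval, ascPochhammer_succ_eval]
    push_cast
    generalize (ascPochhammer ℝ j).eval ((d : ℝ) + 1) = a
    have hj := Nat.factorial_pos j
    simp only [Nat.factorial_succ]
    push_cast
    field_simp
    ring

/-- At `d = 1` the formula `finrank_harmonicPolynomials_mul` only says `0 = 0`, so the circle is
counted directly. -/
theorem finrank_harmonicPolynomials_one (j : ℕ) :
    Module.finrank ℝ (harmonicPolynomials 1 j) = if j = 0 then 1 else 2 := by
  match j with
  | 0 => simp [finrank_harmonicPolynomials_of_lt_two]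
  | 1 => simp [finrank_harmonicPolynomials_of_lt_two]
  | j + 2 =>
    have := finrank_harmonicPolynomials_add_two 1 j
    simp only [one_add_one_eq_two, Nat.multichoose_two] at this
    simp only [Nat.add_eq_zero_iff, OfNat.ofNat_ne_zero, and_false, if_false]
    omega

/-! ### Restriction to the sphere -/

theorem eval_smul_of_isHomogeneous {n j : ℕ} {p : MvPolynomial (Fin n) ℝ} (hp : p.IsHomogeneous j)
    (c : ℝ) (y : Fin n → ℝ) :
    MvPolynomial.eval (fun i => c * y i) p = c ^ j * MvPolynomial.eval y p := by
  rw [MvPolynomial.eval_eq, MvPolynomial.eval_eq, Finset.mul_sum]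
  refine Finset.sum_congr rfl fun m hm => ?_
  have hj : ∑ i ∈ m.support, m i = j := by
    by_contra h
    exact MvPolynomial.mem_support_iff.1 hm (hp.coeff_eq_zero h)
  simp only [mul_pow, Finset.prod_mul_distrib, Finset.prod_pow_eq_pow_sum, hj]
  ring

theorem exists_sphere_smul {d : ℕ} (y : EuclideanSpace ℝ (Fin (d + 1))) :
    ∃ x : Sph d, y = ‖y‖ • (x : EuclideanSpace ℝ (Fin (d + 1))) := by
  by_cases hy : y = 0
  · exact ⟨⟨EuclideanSpace.single 0 1, by simp⟩, by simp [hy]⟩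
  · have hn : ‖y‖ ≠ 0 := norm_ne_zero_iff.2 hy
    exact ⟨⟨‖y‖⁻¹ • y, by simp [norm_smul, hn]⟩, by simp [smul_smul, hn]⟩

theorem eval_eq_norm_pow_mul_restrictToSphere {d j : ℕ} {p : MvPolynomial (Fin (d + 1)) ℝ}
    (hp : p.IsHomogeneous j) {y : EuclideanSpace ℝ (Fin (d + 1))} {x : Sph d}
    (h : y = ‖y‖ • (x : EuclideanSpace ℝ (Fin (d + 1)))) :
    MvPolynomial.eval (fun i => y i) p = ‖y‖ ^ j * restrictToSphere d p x := by
  conv_lhs => rw [h]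
  exact eval_smul_of_isHomogeneous hp _ _

/-- Homogeneity recovers a form from its values on the sphere. Hence the dimension of the spherical
harmonics can be counted among polynomials. -/
theorem eq_zero_of_restrictToSphere_eq_zero {d j : ℕ} {p : MvPolynomial (Fin (d + 1)) ℝ}
    (hp : p.IsHomogeneous j) (h : restrictToSphere d p = 0) : p = 0 := by
  refine MvPolynomial.funext fun y => ?_
  obtain ⟨x, hx⟩ := exists_sphere_smul (WithLp.toLp 2 y)
  have := eval_eq_norm_pow_mul_restrictToSphere hp hx
  simpa [h] using this

theorem dimH_eq (d j : ℕ) : dimH d j = Module.finrank ℝ (harmonicPolynomials d j) := by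
  rw [dimH, sphericalHarmonics]
  rw [← LinearMap.range_domRestrict]
  refine LinearMap.finrank_range_of_inj (LinearMap.ker_eq_bot.1 (LinearMap.ker_eq_bot'.2 ?_))
  rintro ⟨p, hp⟩ h
  ext1
  exact eq_zero_of_restrictToSphere_eq_zero hp.1 h

instance (d j : ℕ) : FiniteDimensional ℝ (harmonicPolynomials d j) :=
  Submodule.finiteDimensional_inf_left _ _

instance (d j : ℕ) : FiniteDimensional ℝ (sphericalHarmonics d j) := by
  unfold sphericalHarmonics
  infer_instance

/-- The coefficient of the series is chosen to cancel the factor `dim H_j` of the addition theorem.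
-/
theorem fieldCoeff_sq_mul_dimH {d : ℕ} (hd : 1 ≤ d) (j : ℕ) :
    fieldCoeff d j ^ 2 * dimH d j = 1 := by
  rw [dimH_eq]
  by_cases h : d = 1
  · subst h
    rw [finrank_harmonicPolynomials_one, fieldCoeff, if_pos rfl]
    by_cases hj : j = 0
    · simp [hj]
    · simp [hj]
  · have hd2 : 2 ≤ d := by omega
    have hdr : (2 : ℝ) ≤ d := by exact_mod_cast hd2
    have hC := gegenbauer_at_one_pos hd2 j
    have hj : (0 : ℝ) ≤ j := j.cast_nonneg
    have hD : 0 < (2 * (j : ℝ) + d - 1) * gegenbauer (((d : ℝ) - 1) / 2) j 1 :=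
      mul_pos (by linarith) hC
    rw [fieldCoeff, if_neg h, Real.sq_sqrt (div_nonneg (by linarith) hD.le), div_mul_eq_mul_div,
      div_eq_one_iff_eq hD.ne', mul_comm, finrank_harmonicPolynomials_mul]

/-! ### Zonal harmonic polynomials -/

/-- The polynomial `x₀² + ⋯ + x_d²`. -/
def normSqPoly (d : ℕ) : MvPolynomial (Fin (d + 1)) ℝ := ∑ i, MvPolynomial.X i ^ 2

theorem isHomogeneous_normSqPoly (d : ℕ) : (normSqPoly d).IsHomogeneous 2 :=
  MvPolynomial.IsHomogeneous.sum _ _ _ fun _ _ => MvPolynomial.isHomogeneous_X_pow _ _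

theorem pderiv_normSqPoly (d : ℕ) (i : Fin (d + 1)) :
    MvPolynomial.pderiv i (normSqPoly d) = 2 * MvPolynomial.X i := by
  rw [normSqPoly, map_sum, Finset.sum_eq_single i]
  · simp
  · intro k _ hk
    simp [MvPolynomial.pderiv_X_of_ne hk]
  · simp

theorem polyLaplacian_X_mul (d : ℕ) (q : MvPolynomial (Fin (d + 1)) ℝ) :
    polyLaplacian d (MvPolynomial.X 0 * q) =
      MvPolynomial.X 0 * polyLaplacian d q + 2 * MvPolynomial.pderiv 0 q := by
  have h : ∀ i : Fin (d + 1), MvPolynomial.pderiv i (MvPolynomial.pderiv i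
      (MvPolynomial.X 0 * q)) = MvPolynomial.X 0 * MvPolynomial.pderiv i (MvPolynomial.pderiv i q)
        + if i = 0 then 2 * MvPolynomial.pderiv 0 q else 0 := by
    intro i
    by_cases hi : i = 0
    · subst hi
      simp only [MvPolynomial.pderiv_mul, MvPolynomial.pderiv_X_self, map_add, if_true, one_mul]
      ring
    · simp [MvPolynomial.pderiv_X_of_ne (Ne.symm hi), hi]
  simp only [polyLaplacian_apply, h, Finset.sum_add_distrib, Finset.mul_sum,
    Finset.sum_ite_eq', Finset.mem_univ, if_true]

theorem polyLaplacian_normSqPoly_mul {d j : ℕ} {q : MvPolynomial (Fin (d + 1)) ℝ}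
    (hq : q.IsHomogeneous j) :
    polyLaplacian d (normSqPoly d * q) =
      normSqPoly d * polyLaplacian d q + (2 * (d + 1) + 4 * j) * q := by
  have h : ∀ i : Fin (d + 1), MvPolynomial.pderiv i (MvPolynomial.pderiv i
      (normSqPoly d * q)) = normSqPoly d * MvPolynomial.pderiv i (MvPolynomial.pderiv i q)
        + 4 * (MvPolynomial.X i * MvPolynomial.pderiv i q) + 2 * q := by
    intro i
    have h2 : MvPolynomial.pderiv i (2 : MvPolynomial (Fin (d + 1)) ℝ) = 0 :=
      MvPolynomial.pderiv_C (a := (2 : ℝ))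
    simp only [MvPolynomial.pderiv_mul, pderiv_normSqPoly, map_add, MvPolynomial.pderiv_X_self, h2]
    ring
  simp only [polyLaplacian_apply, h, Finset.sum_add_distrib, ← Finset.mul_sum,
    hq.sum_X_mul_pderiv, Finset.sum_const, Finset.card_univ, Fintype.card_fin, nsmul_eq_mul]
  push_cast
  ring

/-- The zonal harmonic polynomial with pole `e₀`, the homogenization of `stdGegenbauer d j`. -/
def zonalHarmonic (d : ℕ) : ℕ → MvPolynomial (Fin (d + 1)) ℝ
  | 0 => 1
  | 1 => MvPolynomial.X 0
  | j + 2 => (MvPolynomial.C ((j + d : ℝ)⁻¹) : MvPolynomial (Fin (d + 1)) ℝ) *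
      ((2 * j + d + 1) * ((MvPolynomial.X 0 : MvPolynomial (Fin (d + 1)) ℝ) * zonalHarmonic d (j + 1)) -
        (j + 1) * (normSqPoly d * zonalHarmonic d j))

theorem zonalHarmonic_recurrence {d : ℕ} (hd : 1 ≤ d) (j : ℕ) :
    ((j : MvPolynomial (Fin (d + 1)) ℝ) + d) * zonalHarmonic d (j + 2) =
      (2 * j + d + 1) * ((MvPolynomial.X 0 : MvPolynomial (Fin (d + 1)) ℝ) * zonalHarmonic d (j + 1)) -
        (j + 1) * (normSqPoly d * zonalHarmonic d j) := by
  have h : ((j : ℝ) + d) ≠ 0 := by positivity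
  have hc : ((j : MvPolynomial (Fin (d + 1)) ℝ) + d) =
    (MvPolynomial.C ((j : ℝ) + d) : MvPolynomial (Fin (d + 1)) ℝ) := by simp
  rw [zonalHarmonic, ← mul_assoc, hc, ← MvPolynomial.C_mul, mul_inv_cancel₀ h, MvPolynomial.C_1,
    one_mul]

theorem isHomogeneous_natCast_mul {n j : ℕ} {q : MvPolynomial (Fin n) ℝ}
    (hq : q.IsHomogeneous j) (k : ℕ) : ((k : MvPolynomial (Fin n) ℝ) * q).IsHomogeneous j := by
  rw [← nsmul_eq_mul]
  exact (MvPolynomial.homogeneousSubmodule (Fin n) ℝ j).nsmul_mem hq k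

theorem isHomogeneous_zonalHarmonic (d j : ℕ) : (zonalHarmonic d j).IsHomogeneous j := by
  induction j using Nat.twoStepInduction with
  | zero => exact MvPolynomial.isHomogeneous_one _ _
  | one => exact MvPolynomial.isHomogeneous_X _ _
  | more j h0 h1 =>
    rw [zonalHarmonic]
    refine MvPolynomial.IsHomogeneous.C_mul (MvPolynomial.IsHomogeneous.sub ?_ ?_) _
    · have h := isHomogeneous_natCast_mul ((MvPolynomial.isHomogeneous_X ℝ 0).mul h1) (2 * j + d + 1)
      rw [show 1 + (j + 1) = j + 2 by omega] at h
      exact_mod_cast h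
    · have h := isHomogeneous_natCast_mul ((isHomogeneous_normSqPoly d).mul h0) (j + 1)
      rw [show 2 + j = j + 2 by omega] at h
      exact_mod_cast h

theorem pderiv_natCast_mul {n : ℕ} (i : Fin n) (k : ℕ) (q : MvPolynomial (Fin n) ℝ) :
    MvPolynomial.pderiv i ((k : MvPolynomial (Fin n) ℝ) * q) = k * MvPolynomial.pderiv i q := by
  simp [← nsmul_eq_mul]

theorem polyLaplacian_natCast_mul {d : ℕ} (k : ℕ) (q : MvPolynomial (Fin (d + 1)) ℝ) :
    polyLaplacian d ((k : MvPolynomial (Fin (d + 1)) ℝ) * q) = k * polyLaplacian d q := by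
  simp [← nsmul_eq_mul]

theorem natCast_add_cancel {d : ℕ} (hd : 1 ≤ d) (j : ℕ) {p q : MvPolynomial (Fin (d + 1)) ℝ}
    (h : ((j : MvPolynomial (Fin (d + 1)) ℝ) + d) * p = (j + d) * q) : p = q := by
  refine mul_left_cancel₀ ?_ h
  rw [← Nat.cast_add]
  exact Nat.cast_ne_zero.2 (by omega)

/-- Needed for harmonicity, since the Laplacian of `x₀ q` produces `2 ∂₀ q`. In the induction the
recurrence is differentiated, and the term with `normSqPoly d * zonalHarmonic d j` is eliminated by
the recurrence one degree lower. -/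
theorem pderiv_zonalHarmonic {d : ℕ} (hd : 1 ≤ d) (j : ℕ) :
    MvPolynomial.pderiv 0 (zonalHarmonic d (j + 1)) = (j + 1) * zonalHarmonic d j := by
  have key : ∀ j : ℕ, ((j : MvPolynomial (Fin (d + 1)) ℝ) + d) *
      MvPolynomial.pderiv 0 (zonalHarmonic d (j + 2)) =
      (2 * j + d + 1) * (zonalHarmonic d (j + 1) +
        (MvPolynomial.X 0 : MvPolynomial (Fin (d + 1)) ℝ) * MvPolynomial.pderiv 0 (zonalHarmonic d (j + 1))) -
      (j + 1) * (2 * (MvPolynomial.X 0 : MvPolynomial (Fin (d + 1)) ℝ) * zonalHarmonic d j +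
        normSqPoly d * MvPolynomial.pderiv 0 (zonalHarmonic d j)) := by
    intro j
    have h := congrArg (MvPolynomial.pderiv 0) (zonalHarmonic_recurrence hd j)
    have h1 := pderiv_natCast_mul (0 : Fin (d + 1)) (j + d) (zonalHarmonic d (j + 2))
    have h2 := pderiv_natCast_mul (0 : Fin (d + 1)) (2 * j + d + 1)
      (MvPolynomial.X 0 * zonalHarmonic d (j + 1))
    have h3 := pderiv_natCast_mul (0 : Fin (d + 1)) (j + 1) (normSqPoly d * zonalHarmonic d j)
    push_cast at h1 h2 h3
    rw [map_sub, h1, h2, h3, MvPolynomial.pderiv_mul, MvPolynomial.pderiv_mul,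
      MvPolynomial.pderiv_X_self, pderiv_normSqPoly, one_mul] at h
    exact h
  induction j using Nat.twoStepInduction with
  | zero => simp [zonalHarmonic]
  | one =>
    refine natCast_add_cancel hd 0 ?_
    have h := key 0
    simp only [zonalHarmonic, MvPolynomial.pderiv_X_self, MvPolynomial.pderiv_one] at h ⊢
    push_cast at h ⊢
    linear_combination h
  | more j h0 h1 =>
    refine natCast_add_cancel hd (j + 1) ?_
    have h := key (j + 1)
    have hr := zonalHarmonic_recurrence hd j
    rw [h1, h0] at h
    push_cast at h ⊢
    linear_combination h + (-(j : MvPolynomial (Fin (d + 1)) ℝ) - 2) * hr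

/-- Applying the Laplacian to the recurrence leaves two multiples of `zonalHarmonic d j`, which
cancel because `2(2j+d+1)(j+1) = (j+1)(2(d+1)+4j)`. -/
theorem polyLaplacian_zonalHarmonic {d : ℕ} (hd : 1 ≤ d) (j : ℕ) :
    polyLaplacian d (zonalHarmonic d j) = 0 := by
  induction j using Nat.twoStepInduction with
  | zero => simp [zonalHarmonic, polyLaplacian_apply]
  | one => simpa [zonalHarmonic, polyLaplacian_apply] using polyLaplacian_X_mul d 1
  | more j h0 h1 =>
    refine natCast_add_cancel hd j ?_
    have h := congrArg (polyLaplacian d) (zonalHarmonic_recurrence hd j)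
    have g1 := polyLaplacian_natCast_mul (j + d) (zonalHarmonic d (j + 2))
    have g2 := polyLaplacian_natCast_mul (2 * j + d + 1)
      (MvPolynomial.X 0 * zonalHarmonic d (j + 1))
    have g3 := polyLaplacian_natCast_mul (j + 1) (normSqPoly d * zonalHarmonic d j)
    push_cast at g1 g2 g3
    rw [map_sub, g1, g2, g3, polyLaplacian_X_mul, pderiv_zonalHarmonic hd,
      polyLaplacian_normSqPoly_mul (isHomogeneous_zonalHarmonic d j), h0, h1] at h
    linear_combination h

theorem zonalHarmonic_mem {d : ℕ} (hd : 1 ≤ d) (j : ℕ) :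
    zonalHarmonic d j ∈ harmonicPolynomials d j :=
  mem_harmonicPolynomials.2 ⟨isHomogeneous_zonalHarmonic d j, polyLaplacian_zonalHarmonic hd j⟩

theorem eval_zonalHarmonic {d : ℕ} (hd : 1 ≤ d) (j : ℕ) (y : Fin (d + 1) → ℝ)
    (hy : ∑ i, y i ^ 2 = 1) :
    MvPolynomial.eval y (zonalHarmonic d j) = stdGegenbauer d j (y 0) := by
  induction j using Nat.twoStepInduction with
  | zero => simp [zonalHarmonic, stdGegenbauer_zero]
  | one => simp [zonalHarmonic, stdGegenbauer_one hd]
  | more j h0 h1 =>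
    have hj : ((j : ℝ) + d) ≠ 0 := by positivity
    refine mul_left_cancel₀ hj ?_
    have h := congrArg (MvPolynomial.eval y) (zonalHarmonic_recurrence hd j)
    simp only [map_mul, map_add, map_sub, map_natCast, map_one, map_ofNat, MvPolynomial.eval_X,
      normSqPoly, map_sum, map_pow, hy, h0, h1, one_mul] at h
    rw [h, stdGegenbauer_recurrence hd]

/-- Polynomials whose value at `y` depends only on `y₀` and `‖y‖`. -/
def IsZonal {d : ℕ} (p : MvPolynomial (Fin (d + 1)) ℝ) : Prop :=
  ∀ y z : Fin (d + 1) → ℝ, y 0 = z 0 → ∑ i, y i ^ 2 = ∑ i, z i ^ 2 →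
    MvPolynomial.eval y p = MvPolynomial.eval z p

theorem isZonal_zonalHarmonic (d j : ℕ) : IsZonal (zonalHarmonic d j) := by
  intro y z h0 h
  induction j using Nat.twoStepInduction with
  | zero => simp [zonalHarmonic]
  | one => simp [zonalHarmonic, h0]
  | more j h1 h2 =>
    simp only [zonalHarmonic, map_mul, map_add, map_sub, map_natCast, map_one, map_ofNat,
      MvPolynomial.eval_X, MvPolynomial.eval_C, normSqPoly, map_sum, map_pow, h, h0, h1, h2]

/-- Fixing the last `d` variables at `y` or at `z` gives the same polynomial function of `x₀`, hence
the same coefficients: each coefficient is radial. -/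
theorem IsZonal.eval_coeff_eq {d : ℕ} {p : MvPolynomial (Fin (d + 1)) ℝ} (hp : IsZonal p)
    (k : ℕ) {y z : Fin d → ℝ} (h : ∑ i, y i ^ 2 = ∑ i, z i ^ 2) :
    MvPolynomial.eval y ((MvPolynomial.finSuccEquiv ℝ d p).coeff k) =
      MvPolynomial.eval z ((MvPolynomial.finSuccEquiv ℝ d p).coeff k) := by
  rw [← Polynomial.coeff_map, ← Polynomial.coeff_map]
  congr 1
  refine Polynomial.funext fun t => ?_
  rw [← MvPolynomial.eval_eq_eval_mv_eval', ← MvPolynomial.eval_eq_eval_mv_eval']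
  exact hp _ _ (by simp) (by simp [Fin.sum_univ_succ, h])

/-- The coefficient is a radial form of degree `l`, so its value at one unit vector determines it.
For odd `l` that value is both even and odd under `e ↦ -e`, hence zero. -/
theorem IsZonal.coeff_eq_zero {d j : ℕ} {p : MvPolynomial (Fin (d + 1)) ℝ} (hp : IsZonal p)
    (hj : p.IsHomogeneous j) (i₀ : Fin d) {k l : ℕ} (hkl : k + l = j)
    (h : Odd l ∨ MvPolynomial.eval (Pi.single i₀ 1)
      ((MvPolynomial.finSuccEquiv ℝ d p).coeff k) = 0) :
    (MvPolynomial.finSuccEquiv ℝ d p).coeff k = 0 := by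
  have hl := hj.finSuccEquiv_coeff_isHomogeneous k l hkl
  have hs : ∀ c : ℝ, ∑ i, (c * (Pi.single i₀ 1 : Fin d → ℝ) i) ^ 2 = c ^ 2 := by
    intro c
    rw [Finset.sum_eq_single i₀]
    · simp
    · intro i _ hi
      simp [hi]
    · simp
  have h0 : MvPolynomial.eval (Pi.single i₀ 1)
      ((MvPolynomial.finSuccEquiv ℝ d p).coeff k) = 0 := by
    refine h.elim (fun ho => ?_) id
    have h1 := eval_smul_of_isHomogeneous hl (-1) (Pi.single i₀ 1)
    have h2 := eval_smul_of_isHomogeneous hl 1 (Pi.single i₀ 1)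
    rw [hp.eval_coeff_eq k (z := fun i => 1 * (Pi.single i₀ 1 : Fin d → ℝ) i)
      (by rw [hs, hs]; norm_num), h2, ho.neg_one_pow] at h1
    linarith [one_pow (M := ℝ) l ▸ h1]
  refine MvPolynomial.funext fun y => ?_
  have hy : 0 ≤ ∑ i, y i ^ 2 := Finset.sum_nonneg fun i _ => sq_nonneg _
  rw [hp.eval_coeff_eq k (z := fun i => √(∑ i, y i ^ 2) * (Pi.single i₀ 1 : Fin d → ℝ) i)
    (by rw [hs, Real.sq_sqrt hy]), eval_smul_of_isHomogeneous hl, h0]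
  simp

/-- Only the coefficients of `x₀⁰` and `x₀¹` matter, as Cauchy data. One of them vanishes by parity;
the other has exponent `j % 2` and is controlled by a single number. -/
theorem IsZonal.eq_zero {d j : ℕ} {p : MvPolynomial (Fin (d + 1)) ℝ} (hp : IsZonal p)
    (hj : p ∈ harmonicPolynomials d j) (i₀ : Fin d)
    (h : MvPolynomial.eval (Pi.single i₀ 1)
      ((MvPolynomial.finSuccEquiv ℝ d p).coeff (j % 2)) = 0) : p = 0 := by
  rw [mem_harmonicPolynomials] at hj
  refine eq_zero_of_polyLaplacian_eq_zero hj.2 fun m hm => ?_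
  by_cases hk : m 0 ≤ j
  · rw [← Finsupp.cons_tail m, ← MvPolynomial.finSuccEquiv_coeff_coeff,
      hp.coeff_eq_zero hj.1 i₀ (Nat.add_sub_cancel' hk), MvPolynomial.coeff_zero]
    by_cases ho : Odd (j - m 0)
    · exact Or.inl ho
    · rw [Nat.odd_iff] at ho
      rw [show m 0 = j % 2 by omega]
      exact Or.inr h
  · refine hj.1.coeff_eq_zero fun hm' => hk ?_
    rw [← hm']
    by_cases h0 : (0 : Fin (d + 1)) ∈ m.support
    · exact Finset.single_le_sum (f := fun i => m i) (fun _ _ => Nat.zero_le _) h0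
    · rw [Finsupp.notMem_support_iff.1 h0]; exact Nat.zero_le _

/-- Zonal harmonic polynomials of a given degree are multiples of `zonalHarmonic`. -/
theorem IsZonal.exists_eq_smul {d j : ℕ} (hd : 1 ≤ d) {p : MvPolynomial (Fin (d + 1)) ℝ}
    (hp : IsZonal p) (hj : p ∈ harmonicPolynomials d j) : ∃ c : ℝ, p = c • zonalHarmonic d j := by
  let i₀ : Fin d := ⟨0, hd⟩
  let q := zonalHarmonic d j
  -- By `IsZonal.eq_zero` this linear functional is injective on zonal harmonic polynomials of
  -- degree `j`, so they form at most a line. It is nonzero at `q`, since `q` takes the value `1` at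
  -- the pole.
  let l : MvPolynomial (Fin (d + 1)) ℝ → ℝ := fun p => MvPolynomial.eval (Pi.single i₀ 1)
    ((MvPolynomial.finSuccEquiv ℝ d p).coeff (j % 2))
  have hq0 : l q ≠ 0 := by
    intro h
    have h1 : q = 0 := (isZonal_zonalHarmonic d j).eq_zero (zonalHarmonic_mem hd j) i₀ h
    have h2 := eval_zonalHarmonic hd j (Pi.single 0 1) (by
      rw [Finset.sum_eq_single 0]
      · simp
      · intro i _ hi
        simp [hi]
      · simp)
    rw [show zonalHarmonic d j = 0 from h1, Pi.single_eq_same, stdGegenbauer_at_one hd] at h2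
    simp at h2
  have hr : IsZonal (l q • p - l p • q) := by
    intro y z h0 h
    simp only [map_sub, MvPolynomial.smul_eval, hp y z h0 h, isZonal_zonalHarmonic d j y z h0 h, q]
  have h0 := hr.eq_zero (Submodule.sub_mem _ (Submodule.smul_mem _ _ hj)
    (Submodule.smul_mem _ _ (zonalHarmonic_mem hd j))) i₀ (by
      simp only [map_sub, map_smul, Polynomial.coeff_sub, Polynomial.coeff_smul,
        MvPolynomial.smul_eval]
      exact sub_eq_zero.2 (mul_comm _ _))
  refine ⟨(l q)⁻¹ * l p, ?_⟩
  rw [mul_smul, ← show l q • p = l p • q from sub_eq_zero.1 h0, smul_smul, inv_mul_cancel₀ hq0,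
    one_smul]

/-! ### Rotation invariance -/

/-- The substitution `y ↦ g y` in a polynomial. -/
def rotatePoly {d : ℕ} (g : EuclideanSpace ℝ (Fin (d + 1)) ≃ₗᵢ[ℝ] EuclideanSpace ℝ (Fin (d + 1))) :
    MvPolynomial (Fin (d + 1)) ℝ →ₐ[ℝ] MvPolynomial (Fin (d + 1)) ℝ :=
  MvPolynomial.bind₁ fun k => ∑ l, MvPolynomial.C (g (EuclideanSpace.single l 1) k) *
    MvPolynomial.X l

theorem linearIsometryEquiv_apply_eq_sum {d : ℕ}
    (g : EuclideanSpace ℝ (Fin (d + 1)) ≃ₗᵢ[ℝ] EuclideanSpace ℝ (Fin (d + 1)))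
    (y : EuclideanSpace ℝ (Fin (d + 1))) (k : Fin (d + 1)) :
    g y k = ∑ l, g (EuclideanSpace.single l 1) k * y l := by
  have h : y = ∑ l, y l • (EuclideanSpace.single l 1 : EuclideanSpace ℝ (Fin (d + 1))) := by
    ext i
    simp [Finset.sum_apply, Pi.single_apply]
  conv_lhs => rw [h, map_sum]
  simp [mul_comm]

theorem eval_rotatePoly {d : ℕ}
    (g : EuclideanSpace ℝ (Fin (d + 1)) ≃ₗᵢ[ℝ] EuclideanSpace ℝ (Fin (d + 1)))
    (p : MvPolynomial (Fin (d + 1)) ℝ) (y : EuclideanSpace ℝ (Fin (d + 1))) :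
    MvPolynomial.eval (fun i => y i) (rotatePoly g p) = MvPolynomial.eval (fun i => g y i) p := by
  rw [rotatePoly, MvPolynomial.eval, MvPolynomial.eval₂Hom_bind₁]
  congr 2
  funext k
  rw [linearIsometryEquiv_apply_eq_sum]
  simp

/-- The inverse of an isometry is its adjoint, so the rows of its matrix are orthonormal. This is
what makes the Laplacian rotation invariant. -/
theorem sum_mul_linearIsometryEquiv_apply {d : ℕ}
    (g : EuclideanSpace ℝ (Fin (d + 1)) ≃ₗᵢ[ℝ] EuclideanSpace ℝ (Fin (d + 1)))
    (k m : Fin (d + 1)) :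
    ∑ i, g (EuclideanSpace.single i 1) k * g (EuclideanSpace.single i 1) m =
      if k = m then 1 else 0 := by
  have h : ∀ i k, g (EuclideanSpace.single i 1) k = g.symm (EuclideanSpace.single k 1) i := by
    intro i k
    have h1 := g.inner_map_eq_flip (EuclideanSpace.single i 1) (EuclideanSpace.single k 1)
    simpa [EuclideanSpace.inner_single_left, EuclideanSpace.inner_single_right] using h1
  have h2 := g.symm.inner_map_map (EuclideanSpace.single k 1) (EuclideanSpace.single m 1)
  simp only [h]
  rw [PiLp.inner_apply] at h2
  simp only [RCLike.inner_apply, conj_trivial, EuclideanSpace.inner_single_left, map_one, one_mul]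
    at h2
  simp only [mul_comm] at h2 ⊢
  rw [h2]
  simp

theorem pderiv_rotatePoly {d : ℕ}
    (g : EuclideanSpace ℝ (Fin (d + 1)) ≃ₗᵢ[ℝ] EuclideanSpace ℝ (Fin (d + 1)))
    (p : MvPolynomial (Fin (d + 1)) ℝ) (i : Fin (d + 1)) :
    MvPolynomial.pderiv i (rotatePoly g p) =
      ∑ k, MvPolynomial.C (g (EuclideanSpace.single i 1) k) *
        rotatePoly g (MvPolynomial.pderiv k p) := by
  induction p using MvPolynomial.induction_on with
  | C a => simp [rotatePoly]
  | add p q hp hq => simp only [map_add, hp, hq, mul_add, Finset.sum_add_distrib]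
  | mul_X p n hp =>
    have hX : MvPolynomial.pderiv i (rotatePoly g (MvPolynomial.X n)) =
        MvPolynomial.C (g (EuclideanSpace.single i 1) n) := by
      simp only [rotatePoly, MvPolynomial.bind₁_X_right, map_sum, MvPolynomial.pderiv_C_mul]
      rw [Finset.sum_eq_single i]
      · simp
      · intro l _ hl
        simp [MvPolynomial.pderiv_X_of_ne hl]
      · simp
    rw [map_mul, MvPolynomial.pderiv_mul, hp, hX]
    have h2 : ∀ k, rotatePoly g (MvPolynomial.pderiv k (p * MvPolynomial.X n)) =
        rotatePoly g (MvPolynomial.pderiv k p) * rotatePoly g (MvPolynomial.X n) +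
          if k = n then rotatePoly g p else 0 := by
      intro k
      rw [MvPolynomial.pderiv_mul, map_add, map_mul, map_mul]
      by_cases hk : k = n
      · subst hk; simp
      · simp [MvPolynomial.pderiv_X_of_ne (Ne.symm hk), hk]
    simp only [h2, mul_add, Finset.sum_add_distrib, mul_ite, mul_zero, Finset.sum_ite_eq',
      Finset.mem_univ, if_true, Finset.sum_mul, mul_assoc]
    rw [mul_comm (rotatePoly g p)]

theorem polyLaplacian_rotatePoly {d : ℕ}
    (g : EuclideanSpace ℝ (Fin (d + 1)) ≃ₗᵢ[ℝ] EuclideanSpace ℝ (Fin (d + 1)))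
    (p : MvPolynomial (Fin (d + 1)) ℝ) :
    polyLaplacian d (rotatePoly g p) = rotatePoly g (polyLaplacian d p) := by
  simp only [polyLaplacian_apply, pderiv_rotatePoly, map_sum, MvPolynomial.pderiv_C_mul,
    Finset.mul_sum]
  rw [Finset.sum_comm]
  refine Finset.sum_congr rfl fun k _ => ?_
  rw [Finset.sum_comm]
  have h : ∀ m, ∑ i, MvPolynomial.C (g (EuclideanSpace.single i 1) k) *
      (MvPolynomial.C (g (EuclideanSpace.single i 1) m) *
        rotatePoly g (MvPolynomial.pderiv m (MvPolynomial.pderiv k p))) =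
      if k = m then rotatePoly g (MvPolynomial.pderiv m (MvPolynomial.pderiv k p)) else 0 := by
    intro m
    simp only [← mul_assoc, ← MvPolynomial.C_mul, ← Finset.sum_mul, ← map_sum,
      sum_mul_linearIsometryEquiv_apply]
    split_ifs <;> simp
  simp only [h, Finset.sum_ite_eq, Finset.mem_univ, if_true]

theorem rotatePoly_mem {d j : ℕ}
    (g : EuclideanSpace ℝ (Fin (d + 1)) ≃ₗᵢ[ℝ] EuclideanSpace ℝ (Fin (d + 1)))
    {p : MvPolynomial (Fin (d + 1)) ℝ} (hp : p ∈ harmonicPolynomials d j) :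
    rotatePoly g p ∈ harmonicPolynomials d j := by
  rw [mem_harmonicPolynomials] at hp ⊢
  refine ⟨?_, by rw [polyLaplacian_rotatePoly, hp.2, map_zero]⟩
  have h := hp.1.aeval (n := 1) (fun k => ∑ l, MvPolynomial.C (g (EuclideanSpace.single l 1) k) *
    MvPolynomial.X l) fun k => MvPolynomial.IsHomogeneous.sum _ _ _ fun l _ =>
      MvPolynomial.isHomogeneous_C_mul_X _ _
  rwa [one_mul] at h

/-- The action of a linear isometry on the sphere. -/
def rotateSphere {d : ℕ}
    (g : EuclideanSpace ℝ (Fin (d + 1)) ≃ₗᵢ[ℝ] EuclideanSpace ℝ (Fin (d + 1))) (x : Sph d) :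
    Sph d :=
  ⟨g x, by simp⟩

theorem comp_rotateSphere_mem {d j : ℕ}
    (g : EuclideanSpace ℝ (Fin (d + 1)) ≃ₗᵢ[ℝ] EuclideanSpace ℝ (Fin (d + 1)))
    {f : Sph d → ℝ} (hf : f ∈ sphericalHarmonics d j) :
    f ∘ rotateSphere g ∈ sphericalHarmonics d j := by
  obtain ⟨p, hp, rfl⟩ := hf
  exact ⟨rotatePoly g p, rotatePoly_mem g hp, funext fun x => eval_rotatePoly g p x⟩

theorem continuous_rotateSphere {d : ℕ}
    (g : EuclideanSpace ℝ (Fin (d + 1)) ≃ₗᵢ[ℝ] EuclideanSpace ℝ (Fin (d + 1))) :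
    Continuous (rotateSphere g) :=
  (g.continuous.comp continuous_subtype_val).subtype_mk _

-- Up to a constant, the surface measure of `s` is the volume of the cone over `s`; a linear
-- isometry maps cones to cones and preserves volume.
open scoped Pointwise in
theorem measurePreserving_rotateSphere {d : ℕ}
    (g : EuclideanSpace ℝ (Fin (d + 1)) ≃ₗᵢ[ℝ] EuclideanSpace ℝ (Fin (d + 1))) :
    MeasurePreserving (rotateSphere g) (surfaceMeasure d) (surfaceMeasure d) := by
  have hm := (continuous_rotateSphere g).measurable
  refine ⟨hm, Measure.ext fun s hs => ?_⟩
  rw [Measure.map_apply hm hs, surfaceMeasure, Measure.toSphere_apply' _ (hm hs),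
    Measure.toSphere_apply' _ hs]
  congr 1
  have hg := MeasurePreserving.measure_preimage_equiv (f := g.toMeasurableEquiv)
    g.measurePreserving (Set.Ioo (0 : ℝ) 1 • (Subtype.val '' s))
  rw [← hg]
  congr 1
  ext y
  simp only [Set.mem_smul, Set.mem_image, Set.mem_preimage]
  constructor
  · rintro ⟨c, hc, _, ⟨x, hx, rfl⟩, rfl⟩
    exact ⟨c, hc, _, ⟨_, hx, rfl⟩, (map_smul g c _).symm⟩
  · rintro ⟨c, hc, _, ⟨x, hx, rfl⟩, h⟩
    refine ⟨c, hc, _, ⟨rotateSphere g.symm x, ?_, rfl⟩, ?_⟩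
    · convert hx
      ext1
      simp [rotateSphere]
    · apply g.injective
      rw [map_smul]
      simpa [rotateSphere] using h

/-! ### The addition theorem -/

theorem continuous_of_mem_sphericalHarmonics {d j : ℕ} {f : Sph d → ℝ}
    (hf : f ∈ sphericalHarmonics d j) : Continuous f := by
  obtain ⟨p, -, rfl⟩ := hf
  have := MvPolynomial.continuous_eval p
  exact this.comp (by fun_prop)

instance (d : ℕ) : IsFiniteMeasure (surfaceMeasure d) := by
  unfold surfaceMeasure; infer_instance

theorem integrable_of_continuous {d : ℕ} {f : Sph d → ℝ} (hf : Continuous f) :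
    Integrable f (surfaceMeasure d) :=
  hf.integrable_of_hasCompactSupport (HasCompactSupport.of_compactSpace f)

theorem surfaceMeasure_real_univ_pos (d : ℕ) : 0 < (surfaceMeasure d).real Set.univ := by
  have : (surfaceMeasure d) ≠ 0 := Measure.toSphere_ne_zero _
  have : NeZero (surfaceMeasure d) := ⟨this⟩
  exact measureReal_univ_pos

namespace IsNormalizedHarmonicSystem

variable {d : ℕ} {Y : HarmIndex d → Sph d → ℝ}

theorem continuous (hY : IsNormalizedHarmonicSystem d Y) (q : HarmIndex d) : Continuous (Y q) :=
  continuous_of_mem_sphericalHarmonics (hY.mem q.1 q.2)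

theorem integral_sum_mul_sum (hY : IsNormalizedHarmonicSystem d Y) (j : ℕ)
    (a b : Fin (dimH d j) → ℝ) :
    ∫ x, (∑ k, a k * Y ⟨j, k⟩ x) * (∑ l, b l * Y ⟨j, l⟩ x) ∂(surfaceMeasure d) =
      (∑ k, a k * b k) * (surfaceMeasure d).real Set.univ := by
  have hc : ∀ k l, Integrable (fun x => a k * b l * (Y ⟨j, k⟩ x * Y ⟨j, l⟩ x))
      (surfaceMeasure d) := fun k l => integrable_of_continuous
    (continuous_const.mul ((hY.continuous _).mul (hY.continuous _)))
  have h : ∀ x, (∑ k, a k * Y ⟨j, k⟩ x) * (∑ l, b l * Y ⟨j, l⟩ x) =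
      ∑ k, ∑ l, a k * b l * (Y ⟨j, k⟩ x * Y ⟨j, l⟩ x) := by
    intro x
    rw [Finset.sum_mul_sum]
    exact Finset.sum_congr rfl fun k _ => Finset.sum_congr rfl fun l _ => by ring
  simp only [h]
  rw [integral_finsetSum _ fun k _ => integrable_finsetSum _ fun l _ => hc k l, Finset.sum_mul]
  refine Finset.sum_congr rfl fun k _ => ?_
  rw [integral_finsetSum _ fun l _ => hc k l]
  simp only [integral_const_mul, hY.orthogonal, mul_ite, mul_zero, Finset.sum_ite_eq,
    Finset.mem_univ, if_true]

/-- Orthogonality makes the `Y ⟨j, m⟩` linearly independent, and their number is the dimension, so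
they form a basis. -/
theorem exists_eq_sum (hY : IsNormalizedHarmonicSystem d Y) {j : ℕ} {f : Sph d → ℝ}
    (hf : f ∈ sphericalHarmonics d j) :
    ∃ c : Fin (dimH d j) → ℝ, ∀ x, f x = ∑ m, c m * Y ⟨j, m⟩ x := by
  let v : Fin (dimH d j) → sphericalHarmonics d j := fun m => ⟨Y ⟨j, m⟩, hY.mem j m⟩
  have hv : LinearIndependent ℝ v := by
    refine Fintype.linearIndependent_iff.2 fun c hc => ?_
    have h0 : ∀ x, ∑ m, c m * Y ⟨j, m⟩ x = 0 := by
      intro x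
      have := congrArg (fun w : sphericalHarmonics d j => (w : Sph d → ℝ) x) hc
      simpa [v, Submodule.coe_sum, Finset.sum_apply] using this
    have h1 := hY.integral_sum_mul_sum j c c
    simp only [h0, mul_zero, integral_zero] at h1
    have h2 := (mul_eq_zero.1 h1.symm).resolve_right (surfaceMeasure_real_univ_pos d).ne'
    intro m
    have h3 := (Finset.sum_eq_zero_iff_of_nonneg fun k _ => mul_self_nonneg (c k)).1 h2 m
      (Finset.mem_univ m)
    exact mul_self_eq_zero.1 h3
  let b := basisOfLinearIndependentOfCardEqFinrank' v hv (by rw [Fintype.card_fin]; rfl)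
  refine ⟨fun m => b.repr ⟨f, hf⟩ m, fun x => ?_⟩
  have h := congrArg (fun w : sphericalHarmonics d j => (w : Sph d → ℝ) x) (b.sum_repr ⟨f, hf⟩)
  simp only [b, coe_basisOfLinearIndependentOfCardEqFinrank', v, Submodule.coe_sum,
    Finset.sum_apply, Submodule.coe_smul, Pi.smul_apply, smul_eq_mul] at h
  exact h.symm

/-- The kernel `∑_m Y_m(x) Y_m(y)` is invariant under rotations. -/
theorem kernel_rotate (hY : IsNormalizedHarmonicSystem d Y) (j : ℕ)
    (g : EuclideanSpace ℝ (Fin (d + 1)) ≃ₗᵢ[ℝ] EuclideanSpace ℝ (Fin (d + 1))) (x y : Sph d) :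
    ∑ m, Y ⟨j, m⟩ (rotateSphere g x) * Y ⟨j, m⟩ (rotateSphere g y) =
      ∑ m, Y ⟨j, m⟩ x * Y ⟨j, m⟩ y := by
  choose A hA using fun m => hY.exists_eq_sum (comp_rotateSphere_mem g (hY.mem j m))
  simp only [Function.comp_apply] at hA
  -- The matrix of the rotation in this basis has orthonormal rows, because the surface measure is
  -- rotation invariant.
  have hAA : Matrix.of A * (Matrix.of A).transpose = 1 := by
    ext m k
    have h1 := hY.integral_sum_mul_sum j (A m) (A k)
    simp only [← hA] at h1
    have h2 := integral_map (μ := surfaceMeasure d) (continuous_rotateSphere g).aemeasurable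
      (f := fun x => Y ⟨j, m⟩ x * Y ⟨j, k⟩ x)
      ((hY.continuous _).mul (hY.continuous _)).aestronglyMeasurable
    rw [(measurePreserving_rotateSphere g).map_eq, hY.orthogonal] at h2
    rw [← h2] at h1
    have hS := (surfaceMeasure_real_univ_pos d).ne'
    rw [Matrix.mul_apply, Matrix.one_apply]
    simp only [Matrix.of_apply, Matrix.transpose_apply]
    refine mul_right_cancel₀ hS ?_
    rw [← h1]
    split_ifs <;> simp
  -- The kernel at the rotated points involves `AᵀA` rather than `AAᵀ`; for square matrices one
  -- identity gives the other.
  have hAA' := mul_eq_one_comm.1 hAA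
  have h3 := congrArg (fun M => (fun m => Y ⟨j, m⟩ x) ⬝ᵥ M.mulVec (fun m => Y ⟨j, m⟩ y)) hAA'
  simp only [Matrix.one_mulVec] at h3
  rw [← Matrix.mulVec_mulVec, Matrix.dotProduct_mulVec, Matrix.vecMul_transpose] at h3
  simpa only [dotProduct, Matrix.mulVec, Matrix.of_apply, ← hA] using h3

end IsNormalizedHarmonicSystem

/-- The north pole. -/
def pole (d : ℕ) : Sph d := ⟨EuclideanSpace.single 0 1, by simp⟩

theorem inner_pole {d : ℕ} (y : EuclideanSpace ℝ (Fin (d + 1))) :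
    inner ℝ (pole d : EuclideanSpace ℝ (Fin (d + 1))) y = y 0 := by
  simp [pole, EuclideanSpace.inner_single_left]

/-- The reflection in the hyperplane orthogonal to `x - y` carries `x` to `y` and fixes that
hyperplane pointwise. -/
theorem exists_rotateSphere_eq {d : ℕ} (x y : Sph d) :
    ∃ g : EuclideanSpace ℝ (Fin (d + 1)) ≃ₗᵢ[ℝ] EuclideanSpace ℝ (Fin (d + 1)),
      rotateSphere g x = y ∧ ∀ z : Sph d, inner ℝ (z : EuclideanSpace ℝ (Fin (d + 1))) x =
        inner ℝ (z : EuclideanSpace ℝ (Fin (d + 1))) y → rotateSphere g z = z := by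
  refine ⟨(ℝ ∙ ((x : EuclideanSpace ℝ (Fin (d + 1))) - y))ᗮ.reflection, ?_, ?_⟩
  · exact Subtype.ext (Submodule.reflection_sub (by simp))
  · intro z hz
    refine Subtype.ext (Submodule.reflection_mem_subspace_eq_self ?_)
    rw [Submodule.mem_orthogonal_singleton_iff_inner_left, inner_sub_right, hz, sub_self]

/-- The **addition theorem** for spherical harmonics. -/
theorem IsNormalizedHarmonicSystem.addition {d : ℕ} (hd : 1 ≤ d) {Y : HarmIndex d → Sph d → ℝ}
    (hY : IsNormalizedHarmonicSystem d Y) (j : ℕ) (x y : Sph d) :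
    ∑ m, Y ⟨j, m⟩ x * Y ⟨j, m⟩ y =
      dimH d j * stdGegenbauer d j (inner ℝ (x : EuclideanSpace ℝ (Fin (d + 1))) y) := by
  have hmem : (fun y => ∑ m, Y ⟨j, m⟩ (pole d) * Y ⟨j, m⟩ y) ∈ sphericalHarmonics d j := by
    have := Submodule.sum_mem (sphericalHarmonics d j) (t := Finset.univ) fun m _ =>
      Submodule.smul_mem _ (Y ⟨j, m⟩ (pole d)) (hY.mem j m)
    convert this using 1
    ext y
    simp [Finset.sum_apply]
  obtain ⟨p, hp, hpK⟩ := hmem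
  have hz : IsZonal p := by
    intro v w h0 h
    have hnorm : ‖WithLp.toLp 2 v‖ = ‖WithLp.toLp 2 w‖ := by
      simp [EuclideanSpace.norm_eq, h]
    obtain ⟨x', hx'⟩ := exists_sphere_smul (WithLp.toLp 2 v)
    obtain ⟨y', hy'⟩ := exists_sphere_smul (WithLp.toLp 2 w)
    have e1 := eval_eq_norm_pow_mul_restrictToSphere hp.1 hx'
    have e2 := eval_eq_norm_pow_mul_restrictToSphere hp.1 hy'
    -- At the origin the direction is arbitrary, but then `v = w`. Otherwise the directions of `v`
    -- and `w` have equal height, so the reflection carrying one to the other fixes the pole.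
    by_cases hv : ‖WithLp.toLp 2 v‖ = 0
    · have hw := hnorm ▸ hv
      rw [norm_eq_zero] at hv hw
      rw [show v = w from (WithLp.toLp_injective 2) (hv.trans hw.symm)]
    · rw [e1, e2, hnorm, hpK]
      congr 1
      obtain ⟨g, hg, hfix⟩ := exists_rotateSphere_eq x' y'
      have hpole := hfix (pole d) (by
        rw [inner_pole, inner_pole]
        have f1 := congrArg (fun u : EuclideanSpace ℝ (Fin (d + 1)) => u 0) hx'
        have f2 := congrArg (fun u : EuclideanSpace ℝ (Fin (d + 1)) => u 0) hy'
        simp only [PiLp.smul_apply, smul_eq_mul] at f1 f2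
        rw [← hnorm, ← h0, f1] at f2
        exact mul_left_cancel₀ hv f2)
      have hK := hY.kernel_rotate j g (pole d) x'
      rw [hg, hpole] at hK
      exact hK.symm
  obtain ⟨c, hc⟩ := hz.exists_eq_smul hd hp
  have hpoleK : ∀ y : Sph d, ∑ m, Y ⟨j, m⟩ (pole d) * Y ⟨j, m⟩ y =
      c * stdGegenbauer d j (inner ℝ (pole d : EuclideanSpace ℝ (Fin (d + 1))) y) := by
    intro y
    have h1 := congrFun hpK y
    rw [← h1, hc, inner_pole, ← eval_zonalHarmonic hd j (fun i => (y : EuclideanSpace ℝ _) i)]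
    · simp [restrictToSphere]
    · have := EuclideanSpace.norm_sq_eq (y : EuclideanSpace ℝ (Fin (d + 1)))
      simpa using this.symm
  have hK : ∀ x y : Sph d, ∑ m, Y ⟨j, m⟩ x * Y ⟨j, m⟩ y =
      c * stdGegenbauer d j (inner ℝ (x : EuclideanSpace ℝ (Fin (d + 1))) y) := by
    intro x y
    obtain ⟨g, hg, -⟩ := exists_rotateSphere_eq x (pole d)
    rw [← hY.kernel_rotate j g x y, hg, hpoleK, ← hg]
    simp [rotateSphere]
  -- The diagonal of the kernel is the constant `c`, since `c_j(d,1) = 1`; its integral is `dim H_j`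
  -- times the total area.
  have hcN : c = dimH d j := by
    have h1 : ∀ x, ∑ m, Y ⟨j, m⟩ x * Y ⟨j, m⟩ x = c := by
      intro x
      rw [hK]
      simp [stdGegenbauer_at_one hd]
    have h2 : ∫ x, ∑ m, Y ⟨j, m⟩ x * Y ⟨j, m⟩ x ∂(surfaceMeasure d) =
        dimH d j * (surfaceMeasure d).real Set.univ := by
      rw [integral_finsetSum Finset.univ (f := fun m x => Y ⟨j, m⟩ x * Y ⟨j, m⟩ x) fun m _ =>
        integrable_of_continuous ((hY.continuous _).mul (hY.continuous _))]
      simp [hY.orthogonal]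
    simp only [h1, integral_const, smul_eq_mul] at h2
    rw [mul_comm] at h2
    exact mul_right_cancel₀ (surfaceMeasure_real_univ_pos d).ne' h2
  rw [hK, hcN]

/-! ### Series of independent random variables -/

section Series

variable {Ω : Type*} [MeasurableSpace Ω] {P : Measure Ω} [IsProbabilityMeasure P]

theorem eLpNorm_two_eq_sqrt_variance {X : Ω → ℝ} (hX : MemLp X 2 P) (h0 : ∫ ω, X ω ∂P = 0) :
    eLpNorm X 2 P = ENNReal.ofReal √(Var[X; P]) := by
  have h1 := ofReal_variance hX
  have h2 := eLpNorm_nnreal_pow_eq_lintegral (μ := P) (f := X) (p := 2) two_ne_zero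
  have h3 : eLpNorm X 2 P ^ 2 = ENNReal.ofReal Var[X; P] := by
    rw [h1, evariance, h0]
    simpa using h2
  have h4 : ENNReal.ofReal √(Var[X; P]) ^ 2 = ENNReal.ofReal Var[X; P] := by
    rw [← ENNReal.ofReal_pow (Real.sqrt_nonneg _), Real.sq_sqrt (variance_nonneg _ _)]
  exact (ENNReal.pow_right_strictMono two_ne_zero).injective (h3.trans h4.symm)

theorem eLpNorm_two_sum {W : ℕ → Ω → ℝ} (hW : iIndepFun W P) (hL : ∀ j, MemLp (W j) 2 P)
    (h0 : ∀ j, ∫ ω, W j ω ∂P = 0) (s : Finset ℕ) :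
    eLpNorm (∑ j ∈ s, W j) 2 P = ENNReal.ofReal √(∑ j ∈ s, Var[W j; P]) := by
  rw [eLpNorm_two_eq_sqrt_variance (memLp_finsetSum' s fun j _ => hL j),
    IndepFun.variance_sum (fun j _ => hL j) fun i _ j _ hij => hW.indepFun hij]
  simp only [Finset.sum_apply]
  rw [integral_finsetSum s fun j _ => (hL j).integrable one_le_two]
  simp [h0]

/-- The partial sums form a martingale bounded in `L²`, hence in `L¹`, and Doob's convergence
theorem applies. -/
theorem ae_exists_tendsto_sum_of_stronglyMeasurable {W : ℕ → Ω → ℝ}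
    (hm : ∀ j, StronglyMeasurable (W j)) (hW : iIndepFun W P)
    (hL : ∀ j, MemLp (W j) 2 P) (h0 : ∀ j, ∫ ω, W j ω ∂P = 0) {C : ℝ}
    (hC : ∀ n, ∑ j ∈ Finset.range n, Var[W j; P] ≤ C) :
    ∀ᵐ ω ∂P, ∃ z, Tendsto (fun n => ∑ j ∈ Finset.range n, W j ω) atTop (𝓝 z) := by
  -- The sum includes `W n`, so that its increment `W (n + 1)` is independent of the natural
  -- filtration at time `n`.
  let M : ℕ → Ω → ℝ := fun n => ∑ j ∈ Finset.range (n + 1), W j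
  have hML : ∀ n, MemLp (M n) 2 P := fun n => memLp_finsetSum' _ fun j _ => hL j
  have hmart : Martingale M (Filtration.natural W hm) P := by
    refine martingale_of_condExp_sub_eq_zero_nat (fun n => ?_)
      (fun n => (hML n).integrable one_le_two) fun n => ?_
    · refine Finset.stronglyMeasurable_sum _ fun j hj => ?_
      exact (Filtration.stronglyAdapted_natural hm j).mono
        ((Filtration.natural W hm).mono (Nat.lt_succ_iff.1 (Finset.mem_range.1 hj)))
    · have h1 : M (n + 1) - M n = W (n + 1) := by
        simp only [M]
        rw [Finset.sum_range_succ _ (n + 1), add_sub_cancel_left]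
      rw [h1]
      refine (iIndepFun.condExp_natural_ae_eq_of_lt hm hW (Nat.lt_succ_self n)).trans ?_
      rw [h0]
      rfl
  have hb : ∀ n, eLpNorm (M n) 1 P ≤ (Real.toNNReal √C : NNReal) := by
    intro n
    refine (eLpNorm_le_eLpNorm_of_exponent_le one_le_two (hML n).1).trans ?_
    rw [eLpNorm_two_sum hW hL h0]
    exact ENNReal.ofReal_le_ofReal (Real.sqrt_le_sqrt (hC _))
  filter_upwards [hmart.submartingale.exists_ae_tendsto_of_bdd hb] with ω hω
  obtain ⟨z, hz⟩ := hω
  refine ⟨z, (tendsto_add_atTop_iff_nat 1).1 ?_⟩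
  simpa [M, Finset.sum_apply] using hz

/-- Kolmogorov's one-series theorem. -/
theorem ae_exists_tendsto_sum {W : ℕ → Ω → ℝ} (hW : iIndepFun W P)
    (hL : ∀ j, MemLp (W j) 2 P) (h0 : ∀ j, ∫ ω, W j ω ∂P = 0) {C : ℝ}
    (hC : ∀ n, ∑ j ∈ Finset.range n, Var[W j; P] ≤ C) :
    ∀ᵐ ω ∂P, ∃ z, Tendsto (fun n => ∑ j ∈ Finset.range n, W j ω) atTop (𝓝 z) := by
  let W' : ℕ → Ω → ℝ := fun j => (hL j).1.mk
  have hae : ∀ j, W j =ᵐ[P] W' j := fun j => (hL j).1.ae_eq_mk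
  have h := ae_exists_tendsto_sum_of_stronglyMeasurable (W := W') (P := P)
    (fun j => (hL j).1.stronglyMeasurable_mk) (hW.congr hae)
    (fun j => (memLp_congr_ae (hae j)).1 (hL j)) (fun j => by rw [← integral_congr_ae (hae j), h0])
    (C := C) (fun n => by simpa only [variance_congr (hae _)] using hC n)
  filter_upwards [h, ae_all_iff.2 hae] with ω h1 h2
  simpa only [h2] using h1

/-- By Fatou, the distance from the `n`-th partial sum to the limit is at most the square root of
the tail of the variance series. -/
theorem tendsto_eLpNorm_two_sum_sub {W : ℕ → Ω → ℝ} (hW : iIndepFun W P)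
    (hL : ∀ j, MemLp (W j) 2 P) (h0 : ∀ j, ∫ ω, W j ω ∂P = 0) {v : ℝ}
    (hv : Tendsto (fun n => ∑ j ∈ Finset.range n, Var[W j; P]) atTop (𝓝 v)) {Z : Ω → ℝ}
    (hZ : ∀ᵐ ω ∂P, Tendsto (fun n => ∑ j ∈ Finset.range n, W j ω) atTop (𝓝 (Z ω))) :
    Tendsto (fun n => eLpNorm (fun ω => ∑ j ∈ Finset.range n, W j ω - Z ω) 2 P) atTop (𝓝 0) := by
  have hmono : Monotone fun n => ∑ j ∈ Finset.range n, Var[W j; P] :=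
    monotone_nat_of_le_succ fun n => by
      rw [Finset.sum_range_succ]
      exact le_add_of_nonneg_right (variance_nonneg _ _)
  have hb : ∀ n, eLpNorm (fun ω => ∑ j ∈ Finset.range n, W j ω - Z ω) 2 P ≤
      ENNReal.ofReal √(v - ∑ j ∈ Finset.range n, Var[W j; P]) := by
    intro n
    refine Lp.eLpNorm_le_of_ae_tendsto (u := atTop)
      (f := fun m ω => ∑ j ∈ Finset.range n, W j ω - ∑ j ∈ Finset.range m, W j ω) ?_ ?_ ?_
    · filter_upwards [eventually_ge_atTop n] with m hm
      have h1 : (fun ω => ∑ j ∈ Finset.range n, W j ω - ∑ j ∈ Finset.range m, W j ω) =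
          -∑ j ∈ Finset.Ico n m, W j := by
        ext ω
        rw [Pi.neg_apply, Finset.sum_apply, Finset.sum_Ico_eq_sub _ hm]
        ring
      rw [h1, eLpNorm_neg, eLpNorm_two_sum hW hL h0, Finset.sum_Ico_eq_sub _ hm]
      exact ENNReal.ofReal_le_ofReal (Real.sqrt_le_sqrt
        (sub_le_sub_right (hmono.ge_of_tendsto hv m) _))
    · intro m
      exact ((memLp_finsetSum _ fun j _ => hL j).sub (memLp_finsetSum _ fun j _ => hL j)).1
    · filter_upwards [hZ] with ω hω
      exact tendsto_const_nhds.sub hω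
  refine tendsto_of_tendsto_of_tendsto_of_le_of_le tendsto_const_nhds ?_ (fun _ => zero_le) hb
  have h2 := ENNReal.tendsto_ofReal ((Real.continuous_sqrt.tendsto _).comp
    (tendsto_const_nhds (x := v) |>.sub hv))
  simpa using h2

/-! ### Limits in `L²` -/

omit [IsProbabilityMeasure P] in
theorem tendsto_integral_mul {f g : ℕ → Ω → ℝ} {F G : Ω → ℝ}
    (hf : ∀ n, MemLp (f n) 2 P) (hF : MemLp F 2 P) (hg : ∀ n, MemLp (g n) 2 P) (hG : MemLp G 2 P)
    (hfF : Tendsto (fun n => eLpNorm (f n - F) 2 P) atTop (𝓝 0))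
    (hgG : Tendsto (fun n => eLpNorm (g n - G) 2 P) atTop (𝓝 0)) :
    Tendsto (fun n => ∫ ω, f n ω * g n ω ∂P) atTop (𝓝 (∫ ω, F ω * G ω ∂P)) := by
  have h1 := (Lp.tendsto_Lp_iff_tendsto_eLpNorm'' f hf F hF).2 hfF
  have h2 := (Lp.tendsto_Lp_iff_tendsto_eLpNorm'' g hg G hG).2 hgG
  have key : ∀ {u v : Ω → ℝ} (hu : MemLp u 2 P) (hv : MemLp v 2 P),
      inner ℝ (hu.toLp u) (hv.toLp v) = ∫ ω, u ω * v ω ∂P := by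
    intro u v hu hv
    rw [L2.inner_def]
    refine integral_congr_ae ?_
    filter_upwards [hu.coeFn_toLp, hv.coeFn_toLp] with ω h3 h4
    rw [h3, h4]
    simp [mul_comm]
  simpa only [key] using h1.inner (𝕜 := ℝ) h2

theorem tendsto_integral_of_eLpNorm_two {f : ℕ → Ω → ℝ} {F : Ω → ℝ}
    (hf : ∀ n, MemLp (f n) 2 P) (hF : MemLp F 2 P)
    (hfF : Tendsto (fun n => eLpNorm (f n - F) 2 P) atTop (𝓝 0)) :
    Tendsto (fun n => ∫ ω, f n ω ∂P) atTop (𝓝 (∫ ω, F ω ∂P)) := by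
  simpa using tendsto_integral_mul (g := fun _ _ => 1) (G := fun _ => 1) hf hF
    (fun _ => memLp_const 1) (memLp_const 1) hfF (by simp)

theorem tendsto_covariance {f g : ℕ → Ω → ℝ} {F G : Ω → ℝ}
    (hf : ∀ n, MemLp (f n) 2 P) (hF : MemLp F 2 P) (hg : ∀ n, MemLp (g n) 2 P) (hG : MemLp G 2 P)
    (hfF : Tendsto (fun n => eLpNorm (f n - F) 2 P) atTop (𝓝 0))
    (hgG : Tendsto (fun n => eLpNorm (g n - G) 2 P) atTop (𝓝 0)) :
    Tendsto (fun n => cov[f n, g n; P]) atTop (𝓝 cov[F, G; P]) := by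
  simp only [covariance_eq_sub (hf _) (hg _), covariance_eq_sub hF hG]
  exact (tendsto_integral_mul hf hF hg hG hfF hgG).sub
    ((tendsto_integral_of_eLpNorm_two hf hF hfF).mul (tendsto_integral_of_eLpNorm_two hg hG hgG))

omit [IsProbabilityMeasure P] in
theorem memLp_two_of_tendsto {f : ℕ → Ω → ℝ} {F : Ω → ℝ} (hf : ∀ n, MemLp (f n) 2 P)
    (hF : AEStronglyMeasurable F P)
    (hfF : Tendsto (fun n => eLpNorm (f n - F) 2 P) atTop (𝓝 0)) : MemLp F 2 P := by
  obtain ⟨n, hn⟩ := (hfF.eventually_lt_const ENNReal.zero_lt_top).exists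
  have h : MemLp (f n - F) 2 P := ⟨(hf n).1.sub hF, hn⟩
  simpa using (hf n).sub h

theorem tendsto_cexp_mul_I_sub_div_two {a b : ℕ → ℝ} {A B : ℝ} (ha : Tendsto a atTop (𝓝 A))
    (hb : Tendsto b atTop (𝓝 B)) :
    Tendsto (fun n => Complex.exp (a n * Complex.I - b n / 2)) atTop
      (𝓝 (Complex.exp (A * Complex.I - B / 2))) := by
  have ha' := (Complex.continuous_ofReal.tendsto A).comp ha
  have hb' := (Complex.continuous_ofReal.tendsto B).comp hb
  exact (Complex.continuous_exp.tendsto _).comp ((ha'.mul_const Complex.I).sub (hb'.div_const 2))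

/-- A limit, almost surely and in `L²`, of Gaussian processes is a Gaussian process. -/
theorem isGaussianProcess_of_tendsto {T : Type*} {V : ℕ → T → Ω → ℝ} {Z : T → Ω → ℝ}
    (hV : ∀ n, IsGaussianProcess (V n) P)
    (hae : ∀ t, ∀ᵐ ω ∂P, Tendsto (fun n => V n t ω) atTop (𝓝 (Z t ω)))
    (hL : ∀ t, Tendsto (fun n => eLpNorm (V n t - Z t) 2 P) atTop (𝓝 0)) :
    IsGaussianProcess Z P where
  hasGaussianLaw I := by
    have hVL : ∀ n t, MemLp (V n t) 2 P := fun n t => ((hV n).hasGaussianLaw_eval t).memLp_two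
    have hZm : ∀ t, AEStronglyMeasurable (Z t) P :=
      fun t => aestronglyMeasurable_of_tendsto_ae atTop (fun n => (hVL n t).1) (hae t)
    have hZL : ∀ t, MemLp (Z t) 2 P :=
      fun t => memLp_two_of_tendsto (fun n => hVL n t) (hZm t) (hL t)
    have hXm : AEMeasurable (fun ω => I.restrict (Z · ω)) P :=
      aemeasurable_pi_lambda _ fun t => (hZm t).aemeasurable
    rw [hasGaussianLaw_iff_charFunDual_map_eq hXm]
    intro L
    obtain ⟨c, hc⟩ : ∃ c : I → ℝ, ∀ x, L x = ∑ t, c t * x t := by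
      classical
      refine ⟨fun t => L (Pi.single t 1), fun x => ?_⟩
      conv_lhs => rw [← Finset.univ_sum_single x, map_sum]
      refine Finset.sum_congr rfl fun t _ => ?_
      rw [show Pi.single t (x t) = x t • (Pi.single t 1 : I → ℝ) by simp [← Pi.single_smul],
        map_smul, smul_eq_mul, mul_comm]
    have hVX : ∀ n, HasGaussianLaw (fun ω => I.restrict (V n · ω)) P :=
      fun n => (hV n).hasGaussianLaw I
    have hcV : ∀ n, charFunDual (P.map fun ω => I.restrict (V n · ω)) L =
        ∫ ω, Complex.exp (L (I.restrict (V n · ω)) * Complex.I) ∂P := fun n => by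
      rw [charFunDual_apply, integral_map (hVX n).aemeasurable
        (by fun_prop)]
    have hcZ : charFunDual (P.map fun ω => I.restrict (Z · ω)) L =
        ∫ ω, Complex.exp (L (I.restrict (Z · ω)) * Complex.I) ∂P := by
      rw [charFunDual_apply, integral_map hXm (by fun_prop)]
    -- The same characteristic functions are passed to the limit twice: here by dominated
    -- convergence, and in `hlim2` through their Gaussian formula, as means and covariances
    -- converge.
    have hlim1 : Tendsto (fun n => charFunDual (P.map fun ω => I.restrict (V n · ω)) L) atTop
        (𝓝 (charFunDual (P.map fun ω => I.restrict (Z · ω)) L)) := by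
      simp only [hcV, hcZ]
      refine tendsto_integral_of_dominated_convergence (fun _ => 1) (fun n => ?_)
        (integrable_const 1) (fun n => ?_) ?_
      · have := (hVX n).aemeasurable
        exact AEMeasurable.aestronglyMeasurable (by fun_prop)
      · exact Eventually.of_forall fun ω => by rw [Complex.norm_exp_ofReal_mul_I]
      · filter_upwards [ae_all_iff.2 fun t : I => hae t] with ω hω
        have h1 : Tendsto (fun n => I.restrict (V n · ω)) atTop (𝓝 (I.restrict (Z · ω))) :=
          tendsto_pi_nhds.2 hω
        have h2 : Continuous fun x : I → ℝ => Complex.exp (L x * Complex.I) := by fun_prop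
        exact (h2.tendsto _).comp h1
    have hint : ∀ {U : T → Ω → ℝ}, (∀ t, MemLp (U t) 2 P) →
        P[L ∘ fun ω => I.restrict (U · ω)] = ∑ t : I, c t * ∫ ω, U t ω ∂P := by
      intro U hU
      simp only [Function.comp_def, hc, Finset.restrict_def]
      rw [integral_finsetSum Finset.univ (f := fun (t : I) ω => c t * U t ω)
        fun t _ => ((hU t).integrable one_le_two).const_mul _]
      simp only [integral_const_mul]
    have hvar : ∀ {U : T → Ω → ℝ}, (∀ t, MemLp (U t) 2 P) →
        Var[L ∘ fun ω => I.restrict (U · ω); P] =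
          ∑ t : I, ∑ s : I, c t * (c s * cov[U t, U s; P]) := by
      intro U hU
      simp only [Function.comp_def, hc, Finset.restrict_def]
      rw [variance_fun_sum (X := fun (t : I) ω => c t * U t ω) fun t => (hU t).const_mul _]
      simp only [covariance_const_mul_left, covariance_const_mul_right]
      exact Finset.sum_congr rfl fun t _ => Finset.sum_congr rfl fun s _ => by ring
    have hlim2 : Tendsto (fun n => charFunDual (P.map fun ω => I.restrict (V n · ω)) L) atTop
        (𝓝 (Complex.exp ((P[L ∘ fun ω => I.restrict (Z · ω)] : ℝ) * Complex.I
          - Var[L ∘ fun ω => I.restrict (Z · ω); P] / 2))) := by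
      simp only [fun n => (hVX n).charFunDual_map_eq L]
      have h1 : Tendsto (fun n => P[L ∘ fun ω => I.restrict (V n · ω)]) atTop
          (𝓝 (P[L ∘ fun ω => I.restrict (Z · ω)])) := by
        simp only [hint hZL, fun n => hint (hVL n)]
        exact tendsto_finsetSum _ fun t _ => (tendsto_integral_of_eLpNorm_two
          (fun n => hVL n t) (hZL t) (hL t)).const_mul _
      have h2 : Tendsto (fun n => Var[L ∘ fun ω => I.restrict (V n · ω); P]) atTop
          (𝓝 (Var[L ∘ fun ω => I.restrict (Z · ω); P])) := by
        simp only [hvar hZL, fun n => hvar (hVL n)]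
        exact tendsto_finsetSum _ fun t _ => tendsto_finsetSum _ fun s _ =>
          ((tendsto_covariance (fun n => hVL n t) (hZL t) (fun n => hVL n s) (hZL s)
            (hL t) (hL s)).const_mul _).const_mul _
      exact tendsto_cexp_mul_I_sub_div_two h1 h2
    exact tendsto_nhds_unique hlim1 hlim2

end Series

/-! ### The random field -/

section Field

variable {Ω : Type*} [MeasurableSpace Ω] {P : Measure Ω}

/-- Independent Gaussian processes are jointly Gaussian. -/
theorem isGaussianProcess_of_iIndepFun {ι T : Type*} {X : ι → T → Ω → ℝ}
    (hG : ∀ i, IsGaussianProcess (X i) P) (hI : iIndepFun (fun i ω t => X i t ω) P) :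
    IsGaussianProcess (fun (p : ι × T) ω => X p.1 p.2 ω) P where
  hasGaussianLaw I := by
    classical
    -- The finite set `I` is enclosed in the rectangle `Q × S`, where independence of the rows gives
    -- a joint Gaussian law; the law on `I` is a linear image of it.
    let Q := I.image Prod.fst
    let S := I.image Prod.snd
    have h1 : iIndepFun (fun (i : Q) ω => S.restrict (X i · ω)) P :=
      (hI.precomp Subtype.val_injective).comp (fun _ f => S.restrict f)
        fun _ => Finset.measurable_restrict S
    have h2 := h1.hasGaussianLaw fun i : Q => (hG i).hasGaussianLaw S
    let L : (Q → S → ℝ) →L[ℝ] (I → ℝ) := ContinuousLinearMap.pi fun i =>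
      (ContinuousLinearMap.proj (φ := fun _ : S => ℝ)
        ⟨i.1.2, Finset.mem_image_of_mem _ i.2⟩).comp
      (ContinuousLinearMap.proj (φ := fun _ : Q => S → ℝ)
        ⟨i.1.1, Finset.mem_image_of_mem _ i.2⟩)
    exact h2.map_fun L

variable {d : ℕ} {Y : HarmIndex d → Sph d → ℝ} {X : HarmIndex d → ℝ → Ω → ℝ} {φ : ℕ → ℝ → ℝ}
  {ψ : ℝ → ℝ → ℝ}

/-- The term of degree `i.1` of the series at the point `i.2`. -/
def fieldTerm (d : ℕ) (Y : HarmIndex d → Sph d → ℝ) (X : HarmIndex d → ℝ → Ω → ℝ)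
    (i : ℕ × (Sph d × ℝ)) (ω : Ω) : ℝ :=
  fieldCoeff d i.1 * ∑ m : Fin (dimH d i.1), X ⟨i.1, m⟩ i.2.2 ω * Y ⟨i.1, m⟩ i.2.1

omit [MeasurableSpace Ω] in
theorem partialField_eq (n : ℕ) (p : Sph d × ℝ) :
    partialField d Y X n p = fun ω => ∑ j ∈ Finset.range n, fieldTerm d Y X (j, p) ω := rfl

namespace IsSpectralFamily

/-- Gaussianity is joint over degrees as well as points, so that uncorrelated degrees are
independent. -/
theorem isGaussianProcess_fieldTerm (hX : IsSpectralFamily d P φ X) :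
    IsGaussianProcess (fieldTerm d Y X) P := by
  classical
  have hjoint := isGaussianProcess_of_iIndepFun hX.gaussian hX.indep
  refine hjoint.of_isGaussianProcess ?_
  rintro ⟨j, x, t⟩
  let e : Fin (dimH d j) → HarmIndex d × ℝ := fun m => (⟨j, m⟩, t)
  refine ⟨Finset.univ.image e, fieldCoeff d j • ∑ m, Y ⟨j, m⟩ x •
    ContinuousLinearMap.proj (φ := fun _ => ℝ)
      ⟨e m, Finset.mem_image_of_mem _ (Finset.mem_univ m)⟩, fun ω => ?_⟩
  simp [fieldTerm, e, mul_comm]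

theorem isGaussianProcess_partialField (hX : IsSpectralFamily d P φ X) (n : ℕ) :
    IsGaussianProcess (partialField d Y X n) P := by
  classical
  refine hX.isGaussianProcess_fieldTerm.of_isGaussianProcess (X := fieldTerm d Y X) fun p => ?_
  let e : Fin n → ℕ × (Sph d × ℝ) := fun j => (j, p)
  refine ⟨Finset.univ.image e, ∑ j, ContinuousLinearMap.proj (φ := fun _ => ℝ)
      ⟨e j, Finset.mem_image_of_mem _ (Finset.mem_univ j)⟩, fun ω => ?_⟩
  simp [partialField_eq, e, Finset.sum_range]

theorem memLp (hX : IsSpectralFamily d P φ X) (q : HarmIndex d) (t : ℝ) : MemLp (X q t) 2 P :=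
  ((hX.gaussian q).hasGaussianLaw_eval t).memLp_two

theorem memLp_fieldTerm (hX : IsSpectralFamily d P φ X) (i : ℕ × (Sph d × ℝ)) :
    MemLp (fieldTerm d Y X i) 2 P :=
  (hX.isGaussianProcess_fieldTerm.hasGaussianLaw_eval i).memLp_two

theorem memLp_partialField (hX : IsSpectralFamily d P φ X) (n : ℕ) (p : Sph d × ℝ) :
    MemLp (partialField d Y X n p) 2 P :=
  ((hX.isGaussianProcess_partialField n).hasGaussianLaw_eval p).memLp_two

variable [IsProbabilityMeasure P]

theorem integral_fieldTerm (hX : IsSpectralFamily d P φ X) (i : ℕ × (Sph d × ℝ)) :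
    ∫ ω, fieldTerm d Y X i ω ∂P = 0 := by
  simp only [fieldTerm]
  rw [integral_const_mul, integral_finsetSum _ fun m _ =>
    ((hX.memLp _ _).integrable one_le_two).mul_const _]
  simp [integral_mul_const, hX.mean]

theorem integral_partialField (hX : IsSpectralFamily d P φ X) (n : ℕ) (p : Sph d × ℝ) :
    ∫ ω, partialField d Y X n p ω ∂P = 0 := by
  rw [partialField_eq, integral_finsetSum _ fun j _ =>
    (hX.memLp_fieldTerm _).integrable one_le_two]
  simp [hX.integral_fieldTerm]

/-- The covariance of the `X` reduces the double sum to its diagonal, the addition theorem evaluates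
that, and `fieldCoeff_sq_mul_dimH` removes the dimension. -/
theorem covariance_fieldTerm (hX : IsSpectralFamily d P φ X) (hd : 1 ≤ d)
    (hY : IsNormalizedHarmonicSystem d Y) (j k : ℕ) (x y : Sph d) (t s : ℝ) :
    cov[fieldTerm d Y X (j, x, t), fieldTerm d Y X (k, y, s); P] = if j = k then
      φ j (t - s) * stdGegenbauer d j (inner ℝ (x : EuclideanSpace ℝ (Fin (d + 1))) y) else 0 := by
  have h : cov[fieldTerm d Y X (j, x, t), fieldTerm d Y X (k, y, s); P] =
      fieldCoeff d j * (fieldCoeff d k * ∑ m, ∑ l,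
        cov[X ⟨j, m⟩ t, X ⟨k, l⟩ s; P] * Y ⟨j, m⟩ x * Y ⟨k, l⟩ y) := by
    unfold fieldTerm
    rw [covariance_const_mul_left, covariance_const_mul_right, covariance_fun_sum_fun_sum
      (fun m => (hX.memLp _ _).mul_const _) (fun m => (hX.memLp _ _).mul_const _)]
    simp only [covariance_mul_const_left, covariance_mul_const_right]
  rw [h]
  simp only [hX.cov]
  by_cases hjk : j = k
  · subst hjk
    have h1 : ∀ m l : Fin (dimH d j), ((⟨j, m⟩ : HarmIndex d) = ⟨j, l⟩) ↔ m = l := by simp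
    simp only [h1, if_true, ite_mul, zero_mul, Finset.sum_ite_eq, Finset.mem_univ, mul_assoc,
      ← Finset.mul_sum, hY.addition hd]
    linear_combination (φ j (t - s) * stdGegenbauer d j
      (inner ℝ (x : EuclideanSpace ℝ (Fin (d + 1))) y)) * fieldCoeff_sq_mul_dimH hd j
  · have h1 : ∀ m l, ¬ ((⟨j, m⟩ : HarmIndex d) = ⟨k, l⟩) := fun m l h2 =>
      hjk (congrArg Sigma.fst h2)
    simp [h1, hjk]

theorem iIndepFun_fieldTerm (hX : IsSpectralFamily d P φ X) (hd : 1 ≤ d)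
    (hY : IsNormalizedHarmonicSystem d Y) (p : Sph d × ℝ) :
    iIndepFun (fun j => fieldTerm d Y X (j, p)) P := by
  -- The independence criterion concerns families of processes, so each term is viewed as a process
  -- indexed by a single point.
  have hG : IsGaussianProcess (fun (q : (_ : ℕ) × Unit) ω => fieldTerm d Y X (q.1, p) ω) P :=
    hX.isGaussianProcess_fieldTerm.comp_right fun q : (_ : ℕ) × Unit => (q.1, p)
  have h := hG.iIndepFun_of_covariance_eq_zero
    (X := fun (j : ℕ) (_ : Unit) ω => fieldTerm d Y X (j, p) ω)
    (fun j _ => (hX.memLp_fieldTerm (j, p)).1.aemeasurable) (fun j k hjk _ _ => by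
      obtain ⟨x, t⟩ := p
      exact (hX.covariance_fieldTerm hd hY j k x x t t).trans (if_neg hjk))
  exact h.comp (fun _ f => f ()) fun _ => measurable_pi_apply ()

omit [IsProbabilityMeasure P] in
theorem tendsto_sum_schoenberg (hψ : IsSchoenbergExpansion d ψ φ) (x y : Sph d) (u : ℝ) :
    Tendsto (fun n => ∑ j ∈ Finset.range n, φ j u *
      stdGegenbauer d j (inner ℝ (x : EuclideanSpace ℝ (Fin (d + 1))) y)) atTop
      (𝓝 (ψ (inner ℝ (x : EuclideanSpace ℝ (Fin (d + 1))) y) u)) := by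
  refine hψ.uniform.tendsto_at (x := (inner ℝ (x : EuclideanSpace ℝ (Fin (d + 1))) y, u))
    ⟨abs_le.1 ?_, trivial⟩
  simpa using abs_real_inner_le_norm (x : EuclideanSpace ℝ (Fin (d + 1))) y

theorem tendsto_covariance_partialField (hX : IsSpectralFamily d P φ X) (hd : 1 ≤ d)
    (hY : IsNormalizedHarmonicSystem d Y) (hψ : IsSchoenbergExpansion d ψ φ) (x y : Sph d)
    (t s : ℝ) :
    Tendsto (fun n => cov[partialField d Y X n (x, t), partialField d Y X n (y, s); P]) atTop
      (𝓝 (ψ (inner ℝ (x : EuclideanSpace ℝ (Fin (d + 1))) y) (t - s))) := by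
  have h : ∀ n, cov[partialField d Y X n (x, t), partialField d Y X n (y, s); P] =
      ∑ j ∈ Finset.range n, φ j (t - s) *
        stdGegenbauer d j (inner ℝ (x : EuclideanSpace ℝ (Fin (d + 1))) y) := by
    intro n
    rw [partialField_eq, partialField_eq, covariance_fun_sum_fun_sum'
      (fun j _ => hX.memLp_fieldTerm _) (fun j _ => hX.memLp_fieldTerm _)]
    refine Finset.sum_congr rfl fun j hj => ?_
    simp only [hX.covariance_fieldTerm hd hY, Finset.sum_ite_eq, hj, if_true]
  simpa only [h] using tendsto_sum_schoenberg hψ x y (t - s)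

theorem tendsto_sum_variance (hX : IsSpectralFamily d P φ X) (hd : 1 ≤ d)
    (hY : IsNormalizedHarmonicSystem d Y) (hψ : IsSchoenbergExpansion d ψ φ) (p : Sph d × ℝ) :
    Tendsto (fun n => ∑ j ∈ Finset.range n, Var[fieldTerm d Y X (j, p); P]) atTop
      (𝓝 (ψ (inner ℝ (p.1 : EuclideanSpace ℝ (Fin (d + 1))) p.1) 0)) := by
  have h : ∀ j, Var[fieldTerm d Y X (j, p); P] = φ j 0 *
      stdGegenbauer d j (inner ℝ (p.1 : EuclideanSpace ℝ (Fin (d + 1))) p.1) := by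
    intro j
    rw [← covariance_self (hX.memLp_fieldTerm _).1.aemeasurable]
    have := hX.covariance_fieldTerm hd hY j j p.1 p.1 p.2 p.2
    rwa [if_pos rfl, sub_self] at this
  simpa only [h] using tendsto_sum_schoenberg hψ p.1 p.1 0

theorem ae_exists_tendsto (hX : IsSpectralFamily d P φ X) (hd : 1 ≤ d)
    (hY : IsNormalizedHarmonicSystem d Y) (hψ : IsSchoenbergExpansion d ψ φ) (p : Sph d × ℝ) :
    ∀ᵐ ω ∂P, ∃ z : ℝ, Tendsto (fun n => partialField d Y X n p ω) atTop (𝓝 z) := by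
  obtain ⟨C, hC⟩ := (hX.tendsto_sum_variance hd hY hψ p).bddAbove_range
  exact ae_exists_tendsto_sum (hX.iIndepFun_fieldTerm hd hY p)
    (fun j => hX.memLp_fieldTerm (j, p)) (fun j => hX.integral_fieldTerm (j, p))
    (C := C) fun n => hC ⟨n, rfl⟩

theorem exists_isSeriesField (hX : IsSpectralFamily d P φ X) (hd : 1 ≤ d)
    (hY : IsNormalizedHarmonicSystem d Y) (hψ : IsSchoenbergExpansion d ψ φ)
    (hm : ∀ q, Measurable fun w : Ω × ℝ => X q w.2 w.1) :
    ∃ Z : Sph d × ℝ → Ω → ℝ, IsSeriesField d P Y X Z := by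
  -- `limUnder` is defined everywhere and is jointly measurable; for each `p` its default value is
  -- taken only on a null set.
  refine ⟨fun p ω => limUnder atTop fun n => partialField d Y X n p ω, ?_, fun p => ?_⟩
  · have h : ∀ n, Measurable fun w : Ω × (Sph d × ℝ) => partialField d Y X n w.2 w.1 := by
      intro n
      refine Finset.measurable_sum _ fun j _ => (Finset.measurable_sum _ fun m _ => ?_).const_mul _
      exact ((hm ⟨j, m⟩).comp (measurable_fst.prodMk (measurable_snd.comp measurable_snd))).mul
        ((hY.continuous _).measurable.comp (measurable_fst.comp measurable_snd))
    exact (StronglyMeasurable.limUnder fun n => (h n).stronglyMeasurable).measurable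
  · refine tendstoInMeasure_of_tendsto_ae (fun n => (hX.memLp_partialField n p).1) ?_
    filter_upwards [hX.ae_exists_tendsto hd hY hψ p] with ω hω
    exact tendsto_nhds_limUnder hω

/-- Convergence in probability gives a subsequence converging almost surely to `Z p`. The whole
sequence also converges almost surely, so its limit is `Z p`. -/
theorem ae_tendsto (hX : IsSpectralFamily d P φ X) (hd : 1 ≤ d)
    (hY : IsNormalizedHarmonicSystem d Y) (hψ : IsSchoenbergExpansion d ψ φ)
    {Z : Sph d × ℝ → Ω → ℝ} (hZ : IsSeriesField d P Y X Z) (p : Sph d × ℝ) :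
    ∀ᵐ ω ∂P, Tendsto (fun n => partialField d Y X n p ω) atTop (𝓝 (Z p ω)) := by
  obtain ⟨ns, hns, hae⟩ := (hZ.sum p).exists_seq_tendsto_ae
  filter_upwards [hX.ae_exists_tendsto hd hY hψ p, hae] with ω ⟨z, hz⟩ h
  rwa [tendsto_nhds_unique h (hz.comp hns.tendsto_atTop)]

theorem tendsto_eLpNorm (hX : IsSpectralFamily d P φ X) (hd : 1 ≤ d)
    (hY : IsNormalizedHarmonicSystem d Y) (hψ : IsSchoenbergExpansion d ψ φ)
    {Z : Sph d × ℝ → Ω → ℝ} (hZ : IsSeriesField d P Y X Z) (p : Sph d × ℝ) :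
    Tendsto (fun n => eLpNorm (fun ω => partialField d Y X n p ω - Z p ω) 2 P) atTop (𝓝 0) :=
  tendsto_eLpNorm_two_sum_sub (hX.iIndepFun_fieldTerm hd hY p)
    (fun j => hX.memLp_fieldTerm (j, p)) (fun j => hX.integral_fieldTerm (j, p))
    (hX.tendsto_sum_variance hd hY hψ p) (hX.ae_tendsto hd hY hψ hZ p)

end IsSpectralFamily

theorem cos_geodesicDist (x y : Sph d) :
    Real.cos (geodesicDist x y) = inner ℝ (x : EuclideanSpace ℝ (Fin (d + 1))) y := by
  have h : |inner ℝ (x : EuclideanSpace ℝ (Fin (d + 1))) (y : EuclideanSpace ℝ (Fin (d + 1)))| ≤ 1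
    := by simpa using abs_real_inner_le_norm (x : EuclideanSpace ℝ (Fin (d + 1))) y
  exact Real.cos_arccos (abs_le.1 h).1 (abs_le.1 h).2

end Field

end SphereTime

end

theorem mainTheorem7 {Ω : Type*} [MeasurableSpace Ω] (P : Measure Ω) [IsProbabilityMeasure P]
    (d : ℕ) (hd : 1 ≤ d)
    (Y : SphereTime.HarmIndex d → SphereTime.Sph d → ℝ)
    (hY : SphereTime.IsNormalizedHarmonicSystem d Y)
    (ψ : ℝ → ℝ → ℝ) (φ : ℕ → ℝ → ℝ) (hψ : SphereTime.IsSchoenbergExpansion d ψ φ)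
    (X : SphereTime.HarmIndex d → ℝ → Ω → ℝ) (hX : SphereTime.IsSpectralFamily d P φ X) :
    -- the series converges almost surely at every point
    (∀ p : SphereTime.Sph d × ℝ, ∀ᵐ ω ∂P, ∃ z : ℝ,
      Tendsto (fun n => SphereTime.partialField d Y X n p ω) atTop (𝓝 z)) ∧
    -- if the processes are jointly measurable, its sum can be taken to be a random field
    ((∀ q, Measurable fun w : Ω × ℝ => X q w.2 w.1) →
      ∃ Z : SphereTime.Sph d × ℝ → Ω → ℝ, SphereTime.IsSeriesField d P Y X Z) ∧
    -- properties of every random field that is the sum of the series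
    (∀ Z : SphereTime.Sph d × ℝ → Ω → ℝ, SphereTime.IsSeriesField d P Y X Z →
      (∀ p, ∀ᵐ ω ∂P, Tendsto (fun n => SphereTime.partialField d Y X n p ω) atTop (𝓝 (Z p ω))) ∧
      (∀ p, Tendsto (fun n => eLpNorm (fun ω => SphereTime.partialField d Y X n p ω - Z p ω) 2 P)
        atTop (𝓝 0)) ∧
      IsGaussianProcess Z P ∧
      SphereTime.IsIsotropicStationary P Z ∧
      (∀ p, ∫ ω, Z p ω ∂P = 0) ∧
      (∀ (x y : SphereTime.Sph d) (t s : ℝ),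
        cov[Z (x, t), Z (y, s); P] =
          ψ (Real.cos (SphereTime.geodesicDist x y)) (t - s))) := by
  refine ⟨hX.ae_exists_tendsto hd hY hψ, hX.exists_isSeriesField hd hY hψ, fun Z hZ => ?_⟩
  have hae := hX.ae_tendsto hd hY hψ hZ
  have hL := hX.tendsto_eLpNorm hd hY hψ hZ
  have hG : IsGaussianProcess Z P :=
    SphereTime.isGaussianProcess_of_tendsto hX.isGaussianProcess_partialField hae hL
  have hZL : ∀ p, MemLp (Z p) 2 P := fun p => (hG.hasGaussianLaw_eval p).memLp_two
  have hmean : ∀ p, ∫ ω, Z p ω ∂P = 0 := by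
    intro p
    have h := SphereTime.tendsto_integral_of_eLpNorm_two
      (fun n => hX.memLp_partialField n p) (hZL p) (hL p)
    simp only [hX.integral_partialField] at h
    exact tendsto_nhds_unique h tendsto_const_nhds
  have hcov : ∀ (x y : SphereTime.Sph d) (t s : ℝ), cov[Z (x, t), Z (y, s); P] =
      ψ (Real.cos (SphereTime.geodesicDist x y)) (t - s) := by
    intro x y t s
    rw [SphereTime.cos_geodesicDist]
    exact tendsto_nhds_unique (SphereTime.tendsto_covariance
      (fun n => hX.memLp_partialField n _) (hZL _) (fun n => hX.memLp_partialField n _) (hZL _)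
      (hL (x, t)) (hL (y, s))) (hX.tendsto_covariance_partialField hd hY hψ x y t s)
  exact ⟨hae, hL, hG, ⟨hZL, ⟨0, hmean⟩, ⟨ψ, hcov⟩⟩, hmean, hcov⟩
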